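/- Let $\mathcal C$ be a modular tensor category over $\mathbb C$: an abelian, $\mathbb C$-linear, semisimple ribbon category (braided and rigid, with twist $\theta$) with bilinear tensor product, finite-dimensional morphism spaces, simple unit object $\mathbf 1$ and finitely many simple objects up to isomorphism, whose $S$-matrix is invertible. Let $(A,\mu,\Delta,\iota,\epsilon)$ be a commutative Frobenius algebra in $\mathcal C$ with $\dim\mathrm{Hom}_{\mathcal C}(\mathbf 1,A)=1$ and $\theta_A=\mathrm{id}_A$ that is strongly separable ($\mu\circ\Delta$ and $\epsilon\circ\iota$ are nonzero multiples of the identities of $A$ and $\mathbf 1$) and absorbing ($(A\otimes A,\mu\otimes\mathrm{id}_A)\cong(A,\mu)^{\oplus N}$ as left $A$-modules for some positive integer $N$). Let $G=\mathrm{Aut}(A)$ be the group of automorphisms of $A$ as a unital algebra, and let $\mathrm{Rep}\,A$ be the category of left $A$-modules $(V,\rho_V)$ in $\mathcal C$. For $g\in G$ put $T_g(V,\rho_V)=(V,\rho_V\circ(g^{-1}\otimes\mathrm{id}_V))$, and for $X\in\mathcal C$ let $FX=(A\otimes X,\mu\otimes\mathrm{id}_X)$ be the free $A$-module on $X$. Then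 $G$ is finite, and the following hold. (i) For every simple $(V,\rho_V)\in\mathrm{Rep}\,A$, $FV\cong\bigoplus_{g\in G}T_g(V,\rho_V)$ in $\mathrm{Rep}\,A$. (ii) For every simple $(V,\rho_V)\in\mathrm{Rep}\,A$, the set $K=\{g\in G: T_g(V,\rho_V)\cong(V,\rho_V)\text{ in }\mathrm{Rep}\,A\}$ is a subgroup of $G$ with $|K|=\dim\mathrm{Hom}_{\mathcal C}(V,V)$. For every simple $(V',\rho_{V'})\in\mathrm{Rep}\,A$ with $V'\cong V$ in $\mathcal C$ (in particular for every simple $(V,\rho'_V)$), the set $\{g\in G: T_g(V,\rho_V)\cong(V',\rho_{V'})\text{ in }\mathrm{Rep}\,A\}$ is non-empty, has exactly $\dim\mathrm{Hom}_{\mathcal C}(V,V)$ elements, and is a left coset $hK$ of $K$. (iii) For all simple $(V,\rho_V),(W,\rho_W)\in\mathrm{Rep}\,A$, either $V\cong W$ in $\mathcal C$ or $\mathrm{Hom}_{\mathcal C}(V,W)=0$. -/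

import Mathlib

open CategoryTheory MonoidalCategory Limits

universe v u

namespace AnyonCond

/-! ### Direct sums -/

/-- `X` is a direct sum (biproduct) of the family `Y`. -/
def IsDirectSum {D : Type*} [Category D] [HasZeroMorphisms D] {ι : Type*} (X : D) (Y : ι → D) :
    Prop :=
  ∃ b : Bicone Y, Nonempty (b.pt ≅ X) ∧ Nonempty b.IsBilimit

/-! ### Ribbon and modular tensor categories -/

/-- A ribbon structure (twist) on a rigid braided category. -/
class RibbonCategory (C : Type u) [Category.{v} C] [MonoidalCategory C] [BraidedCategory C]
    [RigidCategory C] where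
  /-- The twist `θ`. -/
  twist : ∀ X : C, X ≅ X
  twist_naturality : ∀ {X Y : C} (f : X ⟶ Y), f ≫ (twist Y).hom = (twist X).hom ≫ f
  twist_tensor : ∀ X Y : C,
    (twist (X ⊗ Y)).hom =
      ((β_ X Y).hom ≫ (β_ Y X).hom) ≫ ((twist X).hom ⊗ₘ (twist Y).hom)
  twist_dual : ∀ X : C, (twist Xᘁ).hom = ((twist X).hom)ᘁ

section Trace

variable {C : Type u} [Category.{v} C] [MonoidalCategory C] [BraidedCategory C]
  [RigidCategory C] [RibbonCategory C]

/-- The twist `θ_X : X ⟶ X`. -/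
abbrev twist (X : C) : X ⟶ X := (RibbonCategory.twist X).hom

/-- The quantum trace of an endomorphism in a ribbon category, as an endomorphism of the unit. -/
def qTrace {X : C} (f : X ⟶ X) : 𝟙_ C ⟶ 𝟙_ C :=
  ExactPairing.coevaluation X Xᘁ ≫ ((f ≫ twist X) ▷ Xᘁ) ≫ (β_ X Xᘁ).hom ≫
    ExactPairing.evaluation X Xᘁ

end Trace

/-- A modular tensor category over `ℂ`: a semisimple ribbon category with finite-dimensional
morphism spaces, simple unit and finitely many simple objects up to isomorphism, whose
`S`-matrix is invertible. -/
class ModularTensorCategory (C : Type u) [Category.{v} C] [Abelian C] [Linear ℂ C]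
    [MonoidalCategory C] [MonoidalPreadditive C] [MonoidalLinear ℂ C] [BraidedCategory C]
    [RigidCategory C] [RibbonCategory C] : Prop where
  finiteDimensional_hom : ∀ X Y : C, FiniteDimensional ℂ (X ⟶ Y)
  simple_unit : Simple (𝟙_ C)
  semisimple : ∀ X : C, ∃ (n : ℕ) (S : Fin n → C), (∀ i, Simple (S i)) ∧ IsDirectSum X S
  modular : ∃ (n : ℕ) (L : Fin n → C),
    (∀ i, Simple (L i)) ∧
    (∀ i j, Nonempty (L i ≅ L j) → i = j) ∧
    (∀ X : C, Simple X → ∃ i, Nonempty (X ≅ L i)) ∧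
    ∃ s : Matrix (Fin n) (Fin n) ℂ,
      (∀ i j, qTrace ((β_ (L i) (L j)).hom ≫ (β_ (L j) (L i)).hom) = s i j • 𝟙 (𝟙_ C)) ∧
      IsUnit s.det

/-! ### Frobenius algebras -/

section Algebra

open scoped MonObj ComonObj

variable {C : Type u} [Category.{v} C] [MonoidalCategory C]

/-- The compatibility between product and coproduct in a Frobenius algebra. -/
class IsFrobeniusObj (A : C) [MonObj A] [ComonObj A] : Prop where
  left_frobenius : (A ◁ Δ[A]) ≫ (α_ A A A).inv ≫ (μ[A] ▷ A) = μ[A] ≫ Δ[A]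
  right_frobenius : (Δ[A] ▷ A) ≫ (α_ A A A).hom ≫ (A ◁ μ[A]) = μ[A] ≫ Δ[A]

/-- Strong separability: `μ ∘ Δ` and `ε ∘ ι` are nonzero multiples of the identity. -/
def IsStronglySeparable [Preadditive C] [Linear ℂ C] (A : C) [MonObj A] [ComonObj A] : Prop :=
  ∃ l₁ l₂ : ℂ, l₁ ≠ 0 ∧ l₂ ≠ 0 ∧ Δ[A] ≫ μ[A] = l₁ • 𝟙 A ∧ η[A] ≫ ε[A] = l₂ • 𝟙 (𝟙_ C)

/-- The group of automorphisms of `A` as a unital algebra; `g * h` is `g ∘ h`. -/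
abbrev AlgAut (A : C) [MonObj A] : Type v := Aut (Mon.mk A)

/-- The free `A`-module `FX = (A ⊗ X, μ ⊗ id_X)`. -/
def freeMod (A : C) [MonObj A] (X : C) : CategoryTheory.Mod C A :=
  letI : ModObj A (A ⊗ X) :=
    { smul := (α_ A A X).inv ≫ μ[A] ▷ X
      one_smul := by
        change η[A] ▷ (A ⊗ X) ≫ (α_ A A X).inv ≫ μ[A] ▷ X = (λ_ (A ⊗ X)).hom
        rw [associator_inv_naturality_left_assoc, ← comp_whiskerRight, MonObj.one_mul]
        simp
      mul_smul := by
        change μ[A] ▷ (A ⊗ X) ≫ (α_ A A X).inv ≫ μ[A] ▷ X =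
          (α_ A A (A ⊗ X)).hom ≫ A ◁ ((α_ A A X).inv ≫ μ[A] ▷ X) ≫ (α_ A A X).inv ≫ μ[A] ▷ X
        rw [associator_inv_naturality_left_assoc, ← comp_whiskerRight, MonObj.mul_assoc]
        simp }
  ⟨A ⊗ X⟩

/-- `T_g (V, ρ) = (V, ρ ∘ (g⁻¹ ⊗ id_V))`. -/
def T {A : C} [MonObj A] (g : AlgAut A) (V : CategoryTheory.Mod C A) : CategoryTheory.Mod C A :=
  (Mod.comap (D := C) (g⁻¹).hom.hom).obj V

theorem T_X {A : C} [MonObj A] (g : AlgAut A) (V : CategoryTheory.Mod C A) : (T g V).X = V.X := rfl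

theorem T_smul {A : C} [MonObj A] (g : AlgAut A) (V : CategoryTheory.Mod C A) :
    (T g V).mod.smul = (g⁻¹).hom.hom ▷ V.X ≫ V.mod.smul := rfl

end Algebra

/-! ### Addition of module morphisms -/

section Preadditive

variable {C : Type u} [Category.{v} C] [MonoidalCategory C] [Preadditive C]
  [MonoidalPreadditive C] {A : C} [MonObj A]

instance (V W : CategoryTheory.Mod C A) : Zero (V ⟶ W) := ⟨Mod.Hom.mk' 0 (by simp)⟩
instance (V W : CategoryTheory.Mod C A) : Add (V ⟶ W) :=
  ⟨fun f g => Mod.Hom.mk' (f.hom + g.hom) (by simp)⟩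
instance (V W : CategoryTheory.Mod C A) : Neg (V ⟶ W) :=
  ⟨fun f => Mod.Hom.mk' (-f.hom) (by
    have h := (tensorLeft A).map_neg (f := f.hom)
    simp_all)⟩
instance (V W : CategoryTheory.Mod C A) : Sub (V ⟶ W) :=
  ⟨fun f g => Mod.Hom.mk' (f.hom - g.hom) (by
    have h := (tensorLeft A).map_sub (f := f.hom) (g := g.hom)
    simp_all)⟩
instance (V W : CategoryTheory.Mod C A) : SMul ℕ (V ⟶ W) :=
  ⟨fun n f => Mod.Hom.mk' (n • f.hom) (by
    have h := (tensorLeft A).map_nsmul (f := f.hom) (n := n)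
    simp_all)⟩
instance (V W : CategoryTheory.Mod C A) : SMul ℤ (V ⟶ W) :=
  ⟨fun n f => Mod.Hom.mk' (n • f.hom) (by
    have h := (tensorLeft A).map_zsmul (f := f.hom) (r := n)
    simp_all)⟩

/-- `A`-morphisms are added as morphisms of the underlying objects. -/
instance (V W : CategoryTheory.Mod C A) : AddCommGroup (V ⟶ W) :=
  Function.Injective.addCommGroup (fun f : V ⟶ W => f.hom)
    (fun f g h => Mod.hom_ext f g h) rfl (fun _ _ => rfl) (fun _ => rfl) (fun _ _ => rfl)
    (fun _ _ => rfl) (fun _ _ => rfl)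

instance : Preadditive (CategoryTheory.Mod C A) where
  add_comp _ _ _ _ _ _ := Mod.hom_ext _ _ (Preadditive.add_comp _ _ _ _ _ _)
  comp_add _ _ _ _ _ _ := Mod.hom_ext _ _ (Preadditive.comp_add _ _ _ _ _ _)

/-- `A` is absorbing: `A ⊗ A ≅ A^{⊕N}` as `A`-modules for some positive integer `N`. -/
def IsAbsorbing (A : C) [MonObj A] : Prop :=
  ∃ N : ℕ, 0 < N ∧ IsDirectSum (freeMod A A) (fun _ : Fin N => Mod.regular A)

end Preadditive

end AnyonCond

/-! Everything rests on `End(A)` with the convolution product `f * g = μ(f ⊗ g)Δ`, whose unit is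
`ει`. Absorption and `θ_A = id` make the double braiding on `A ⊗ A` trivial (`braiding_sq_eq`), so
`Δ` is cocommutative and this algebra is commutative. Splitting `A ⊗ A` into copies of `A` gives a
finite spanning set of `End(A)`, from which the trace of convolution by `x` is computed: it is a
nonzero multiple of the coefficient of `x(1)` (`sum_coeff_conv`). The resulting trace form is
nondegenerate, so the algebra is reduced (`isReduced_conv`), hence a product of copies of `ℂ`. Each
minimal idempotent is a multiple of an algebra endomorphism (`exists_isMonHom_of_conv_eq_smul`), and
all such endomorphisms are invertible. Since distinct automorphisms are orthogonal and `g * g = l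
g`, where `μΔ = l id`, the group `G` is finite and `∑ g = l ει` (`finite_algAut_and_sum`).

For a module `V`, the action twisted by `g⁻¹` projects `FV` onto `T_g V`, and `v ↦ g(d') ⊗ d''v`
with `Δ(1) = d' ⊗ d''` includes it back up to the factor `l`. Orthogonality and the sum formula say
exactly that these maps form a direct sum (`freeMod_isDirectSum`). By Frobenius reciprocity and
Schur's lemma, `dim Hom(V, W)` counts the `g` with `T_g V ≅ W` (`finrank_hom_eq_ncard`); (ii) and
(iii) are read off from this count. -/

namespace AnyonCond

open scoped MonObj ComonObj

/-! ### Frobenius algebras: uniqueness of the coproduct and the Frobenius form -/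

section Frobenius

variable {C : Type u} [Category.{v} C] [MonoidalCategory C] {A : C} [MonObj A]

/-- A left linear map out of the regular module is determined by its value at the unit. -/
theorem eq_of_mul_comp {Y : C} {φ : A ⟶ Y} {ψ : A ⊗ Y ⟶ Y} (h : μ[A] ≫ φ = A ◁ φ ≫ ψ) :
    φ = (ρ_ A).inv ≫ A ◁ (η[A] ≫ φ) ≫ ψ := by
  rw [MonoidalCategory.whiskerLeft_comp, Category.assoc, ← h, MonObj.mul_one_assoc,
    Iso.inv_hom_id_assoc]

/-- A right linear map out of the regular module is determined by its value at the unit. -/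
theorem eq_of_mul_comp' {Y : C} {φ : A ⟶ Y} {ψ : Y ⊗ A ⟶ Y} (h : μ[A] ≫ φ = φ ▷ A ≫ ψ) :
    φ = (λ_ A).inv ≫ (η[A] ≫ φ) ▷ A ≫ ψ := by
  rw [comp_whiskerRight, Category.assoc, ← h, MonObj.one_mul_assoc, Iso.inv_hom_id_assoc]

variable [ComonObj A]

/-- Contraction of the second factor against the Frobenius form. -/
def contr {X : C} (w : X ⟶ A ⊗ A) : X ⊗ A ⟶ A :=
  w ▷ A ≫ (α_ A A A).hom ≫ A ◁ (μ[A] ≫ ε[A]) ≫ (ρ_ A).hom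

theorem contr_comp {X Y : C} (f : X ⟶ Y) (w : Y ⟶ A ⊗ A) : contr (f ≫ w) = f ▷ A ≫ contr w := by
  simp [contr]

variable [IsFrobeniusObj A]

theorem comul_eq_left :
    Δ[A] = (ρ_ A).inv ≫ A ◁ (η[A] ≫ Δ[A]) ≫ (α_ A A A).inv ≫ μ[A] ▷ A :=
  eq_of_mul_comp IsFrobeniusObj.left_frobenius.symm

theorem comul_eq_right :
    Δ[A] = (λ_ A).inv ≫ (η[A] ≫ Δ[A]) ▷ A ≫ (α_ A A A).hom ≫ A ◁ μ[A] :=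
  eq_of_mul_comp' IsFrobeniusObj.right_frobenius.symm

/-- The comultiplication of a Frobenius algebra is determined by the algebra and the counit. -/
theorem comul_unique {D : A ⟶ A ⊗ A}
    (hL : A ◁ D ≫ (α_ A A A).inv ≫ μ[A] ▷ A = μ[A] ≫ D)
    (hε : D ≫ ε[A] ▷ A = (λ_ A).inv) : D = Δ[A] := by
  have hD := eq_of_mul_comp hL.symm
  -- Applying `ε` to the middle factor turns the left side into `D` and the right side into `Δ`.
  have key : D ≫ Δ[A] ▷ A ≫ (α_ A A A).hom = Δ[A] ≫ A ◁ D := by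
    conv_rhs => rw [hD]
    conv_lhs => rw [hD]
    have h : μ[A] ▷ A ≫ Δ[A] ▷ A = (Δ[A] ▷ A ≫ (α_ A A A).hom ≫ A ◁ μ[A]) ▷ A := by
      rw [← comp_whiskerRight, IsFrobeniusObj.right_frobenius]
    simp only [Category.assoc]
    rw [reassoc_of% h]
    generalize η[A] ≫ D = d
    simp only [comp_whiskerRight, MonoidalCategory.whiskerLeft_comp, Category.assoc]
    rw [← associator_inv_naturality_left_assoc, whisker_exchange_assoc,
      ← rightUnitor_inv_naturality_assoc]
    monoidal
  have h2 := key =≫ A ◁ ε[A] ▷ A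
  simp only [Category.assoc, ← MonoidalCategory.whiskerLeft_comp, hε] at h2
  rw [← associator_naturality_middle, ← comp_whiskerRight_assoc, ComonObj.comul_counit] at h2
  simpa [← MonoidalCategory.whiskerLeft_comp] using h2 =≫ A ◁ (λ_ A).hom

/-- On elements, `a' ε(a'' b) = ab` by the Frobenius relation and the counit law. At `a = 1` this
recovers `p` from `(p ⊗ id)Δ(1)`. -/
theorem contr_comul (p : A ⟶ A) : contr (Δ[A] ≫ p ▷ A) = μ[A] ≫ p := by
  have h := IsFrobeniusObj.right_frobenius (A := A) =≫ (A ◁ ε[A] ≫ (ρ_ A).hom)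
  simp only [Category.assoc, ComonObj.comul_counit_assoc, Iso.inv_hom_id, Category.comp_id] at h
  rw [← h]
  simp only [contr, comp_whiskerRight, MonoidalCategory.whiskerLeft_comp, Category.assoc]
  rw [associator_naturality_left_assoc, ← whisker_exchange_assoc, ← whisker_exchange_assoc,
    rightUnitor_naturality]

theorem unit_contr_comul (p : A ⟶ A) :
    (λ_ A).inv ≫ contr (η[A] ≫ Δ[A] ≫ p ▷ A) = p := by
  rw [contr_comp, contr_comul, MonObj.one_mul_assoc, Iso.inv_hom_id_assoc]

end Frobenius

section Linear

variable {C : Type u} [Category.{v} C] [MonoidalCategory C] {A : C} [MonObj A]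
  [Preadditive C] [Linear ℂ C] [MonoidalPreadditive C] [MonoidalLinear ℂ C]

theorem eq_smul_of_mul_comp {φ g : A ⟶ A} (h : μ[A] ≫ φ = A ◁ φ ≫ g ▷ A ≫ μ[A]) {c : ℂ}
    (hc : η[A] ≫ φ = c • η[A]) : φ = c • g := by
  rw [eq_of_mul_comp h, hc]
  simp [whisker_exchange_assoc]

theorem eq_smul_of_mul_comp' {φ g : A ⟶ A} (h : μ[A] ≫ φ = φ ▷ A ≫ A ◁ g ≫ μ[A]) {c : ℂ}
    (hc : η[A] ≫ φ = c • η[A]) : φ = c • g := by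
  rw [eq_of_mul_comp' h, hc]
  simp [← whisker_exchange_assoc]

end Linear

/-! ### Convolution of algebra endomorphisms -/

section Convolution

variable {C : Type u} [Category.{v} C] [MonoidalCategory C] {A : C} [MonObj A] [ComonObj A]

/-- The convolution product of endomorphisms of `A`. -/
def conv (f g : A ⟶ A) : A ⟶ A := Δ[A] ≫ f ▷ A ≫ A ◁ g ≫ μ[A]

theorem conv_counit_unit (f : A ⟶ A) : conv f (ε[A] ≫ η[A]) = f :=
  mul_one (M := Conv A A) f

theorem conv_self (g : A ⟶ A) [IsMonHom g] : conv g g = (Δ[A] ≫ μ[A]) ≫ g := by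
  simp [conv, MonoidalCategory.tensorHom_def]

variable [IsFrobeniusObj A]

theorem mul_comp_conv_left (g h : A ⟶ A) [IsMonHom g] :
    μ[A] ≫ conv g h = A ◁ conv g h ≫ g ▷ A ≫ μ[A] := by
  have h1 : μ[A] ▷ A ≫ g ▷ A = ((g ⊗ₘ g) ≫ μ[A]) ▷ A := by
    rw [← comp_whiskerRight, IsMonHom.mul_hom]
  simp only [conv, MonoidalCategory.whiskerLeft_comp, Category.assoc]
  rw [← reassoc_of% IsFrobeniusObj.left_frobenius (A := A), reassoc_of% h1]
  simp only [comp_whiskerRight, Category.assoc, ← whisker_exchange_assoc, MonObj.mul_assoc,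
    tensorHom_def', whisker_assoc, Iso.inv_hom_id_assoc, 
    associator_naturality_right_assoc, associator_naturality_left_assoc]

theorem mul_comp_conv_right (g h : A ⟶ A) [IsMonHom h] :
    μ[A] ≫ conv g h = conv g h ▷ A ≫ A ◁ h ≫ μ[A] := by
  have h1 : A ◁ μ[A] ≫ A ◁ h = A ◁ ((h ⊗ₘ h) ≫ μ[A]) := by
    rw [← MonoidalCategory.whiskerLeft_comp, IsMonHom.mul_hom]
  simp only [conv, comp_whiskerRight, Category.assoc]
  rw [← reassoc_of% IsFrobeniusObj.right_frobenius (A := A), whisker_exchange_assoc,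
    reassoc_of% h1]
  rw [MonoidalCategory.tensorHom_def]
  simp only [MonoidalCategory.whiskerLeft_comp, Category.assoc]
  rw [← associator_naturality_left_assoc, ← associator_naturality_middle_assoc,
    ← associator_naturality_right_assoc, ← MonObj.mul_assoc, whisker_exchange_assoc]

/-- The retraction is the adjoint of `g` for the Frobenius form: `b ↦ d' ε(g(d'') b)`, where `Δ(1) =
d' ⊗ d''`. -/
theorem counit_comp_split {g : A ⟶ A} [IsMonHom g] (hg : g ≫ ε[A] = ε[A]) :
    ∃ r : A ⟶ A, g ≫ r = 𝟙 A := by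
  refine ⟨(λ_ A).inv ≫ (η[A] ≫ Δ[A]) ▷ A ≫ (α_ A A A).hom ≫ A ◁ (g ▷ A ≫ μ[A] ≫ ε[A]) ≫
    (ρ_ A).hom, ?_⟩
  have h1 : A ◁ g ≫ g ▷ A ≫ μ[A] ≫ ε[A] = μ[A] ≫ ε[A] := by
    rw [← tensorHom_def'_assoc, ← IsMonHom.mul_hom_assoc, hg]
  have h2 := comul_eq_right (A := A) =≫ (A ◁ ε[A] ≫ (ρ_ A).hom)
  simp only [ComonObj.comul_counit_assoc, Iso.inv_hom_id, Category.assoc] at h2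
  rw [h2, leftUnitor_inv_naturality_assoc, whisker_exchange_assoc,
    associator_naturality_right_assoc, ← MonoidalCategory.whiskerLeft_comp_assoc, h1]
  simp

/-- An endomorphism of a Frobenius algebra compatible with the product and the counit is
compatible with the coproduct. -/
theorem hom_comul_of_hom_counit (g : A ≅ A) [IsMonHom g.hom] (hg : g.hom ≫ ε[A] = ε[A]) :
    g.hom ≫ Δ[A] = Δ[A] ≫ (g.hom ⊗ₘ g.hom) := by
  have hinv : g.inv ≫ ε[A] = ε[A] := by rw [Iso.inv_comp_eq, hg]
  have : g.hom ≫ Δ[A] ≫ (g.inv ⊗ₘ g.inv) = Δ[A] := by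
    apply comul_unique
    · have h1 : μ[A] ▷ A ≫ (g.inv ⊗ₘ g.inv) = ((g.inv ⊗ₘ g.inv) ⊗ₘ g.inv) ≫ μ[A] ▷ A := by
        simp only [← tensorHom_id, tensorHom_comp_tensorHom, IsMonHom.mul_hom, Category.id_comp,
          Category.comp_id]
      rw [IsMonHom.mul_hom_assoc, ← reassoc_of% IsFrobeniusObj.left_frobenius (A := A), h1,
        ← associator_inv_naturality_assoc]
      simp only [← id_tensorHom, tensorHom_comp_tensorHom_assoc, Category.id_comp,
        Iso.hom_inv_id]
    · rw [Category.assoc, Category.assoc, MonoidalCategory.tensorHom_def', Category.assoc,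
        ← comp_whiskerRight, hinv, whisker_exchange, ComonObj.counit_comul_assoc,
        ← leftUnitor_inv_naturality]
      simp
  conv_rhs => rw [← this]
  simp

section Linear

variable [Preadditive C] [Linear ℂ C] [MonoidalPreadditive C] [MonoidalLinear ℂ C]

/-- The convolution `φ` satisfies `φ(ab) = g(a)φ(b) = φ(a)h(b)`. As `φ(1)` is a scalar `c`, this
gives `φ = c g = c h`. -/
theorem conv_eq_zero
    (hunit : ∀ x : 𝟙_ C ⟶ A, ∃ c : ℂ, x = c • η[A])
    (g h : A ⟶ A) [IsMonHom g] [IsMonHom h] (hgh : g ≠ h) : conv g h = 0 := by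
  obtain ⟨c, hc⟩ := hunit (η[A] ≫ conv g h)
  have h1 := eq_smul_of_mul_comp (mul_comp_conv_left g h) hc
  have h2 := eq_smul_of_mul_comp' (mul_comp_conv_right g h) hc
  by_cases h0 : c = 0
  · simpa [h0] using h1
  · exact absurd (smul_right_injective _ h0 (h1.symm.trans h2)) hgh

theorem hom_counit_of_isMonHom
    (hunit : ∀ x : 𝟙_ C ⟶ A, ∃ c : ℂ, x = c • η[A]) (h0 : η[A] ≫ ε[A] ≠ 0)
    (g : A ⟶ A) [IsMonHom g] : g ≫ ε[A] = ε[A] := by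
  -- This map is right `A`-linear, hence a scalar `c`. Composing with `ε` gives `εg = cε`, and
  -- evaluating at the unit gives `c = 1`.
  let φ : A ⟶ A := Δ[A] ≫ (g ≫ ε[A]) ▷ A ≫ (λ_ A).hom
  have hφ : μ[A] ≫ φ = φ ▷ A ≫ A ◁ 𝟙 A ≫ μ[A] := by
    simp only [φ, ← reassoc_of% IsFrobeniusObj.right_frobenius (A := A)]
    rw [whisker_exchange_assoc]
    simp
  obtain ⟨c, hc⟩ := hunit (η[A] ≫ φ)
  have h1 := eq_smul_of_mul_comp' hφ hc
  have h2 : φ ≫ ε[A] = g ≫ ε[A] := by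
    simp only [φ, Category.assoc, ← leftUnitor_naturality, ← whisker_exchange_assoc,
      ComonObj.comul_counit_assoc]
    simp [unitors_equal]
  rw [h1] at h2
  simp only [Linear.smul_comp, Category.id_comp] at h2
  have h3 := η[A] ≫= h2
  rw [IsMonHom.one_hom_assoc, Linear.comp_smul] at h3
  have : c = 1 := by
    by_contra hne
    apply h0
    have : (c - 1) • (η[A] ≫ ε[A]) = 0 := by rw [sub_smul, h3, one_smul, sub_self]
    exact (smul_eq_zero.mp this).resolve_left (sub_ne_zero.mpr hne)
  rw [← h2, this, one_smul]

end Linear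

end Convolution

/-! ### Contractions of tensors, and when a convolution idempotent is multiplicative -/

section Slide

variable {C : Type u} [Category.{v} C] [MonoidalCategory C] {A : C} [MonObj A]

/-- The map `c ⊗ a ↦ w' · x (w'' a)`, where `w (c) = w' ⊗ w''`. -/
def slide {X : C} (x : A ⟶ A) (w : X ⟶ A ⊗ A) : X ⊗ A ⟶ A :=
  w ▷ A ≫ (α_ A A A).hom ≫ A ◁ (μ[A] ≫ x) ≫ μ[A]

theorem slide_comp {X Y : C} (x : A ⟶ A) (f : X ⟶ Y) (w : Y ⟶ A ⊗ A) :
    slide x (f ≫ w) = f ▷ A ≫ slide x w := by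
  simp [slide]

theorem contr_eq_slide [ComonObj A] {X : C} (w : X ⟶ A ⊗ A) :
    contr w = slide (ε[A] ≫ η[A]) w := by
  simp [slide, contr]

theorem slide_unit (x : A ⟶ A) : slide x ((λ_ A).inv ≫ η[A] ▷ A) = μ[A] ≫ x := by
  simp only [slide, comp_whiskerRight, Category.assoc]
  rw [associator_naturality_left_assoc, ← whisker_exchange_assoc, MonObj.one_mul]
  simp

/-- Left linear maps out of a free module are determined by their restriction to generators. -/
theorem eq_of_whiskerRight_mul_comp {φ : A ⊗ A ⟶ A}
    (h : μ[A] ▷ A ≫ φ = (α_ A A A).hom ≫ A ◁ φ ≫ μ[A]) :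
    φ = A ◁ ((λ_ A).inv ≫ η[A] ▷ A ≫ φ) ≫ μ[A] := by
  have h1 := (A ◁ (λ_ A).inv ≫ A ◁ η[A] ▷ A ≫ (α_ A A A).inv) ≫= h
  simp only [Category.assoc, Iso.inv_hom_id_assoc] at h1
  simp only [MonoidalCategory.whiskerLeft_comp, Category.assoc]
  rw [← h1, associator_inv_naturality_middle_assoc, ← comp_whiskerRight_assoc, MonObj.mul_one]
  simp

theorem slide_linear (x : A ⟶ A) {j : A ⟶ A ⊗ A}
    (hj : μ[A] ≫ j = A ◁ j ≫ (α_ A A A).inv ≫ μ[A] ▷ A) :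
    slide x j = A ◁ ((λ_ A).inv ≫ slide x (η[A] ≫ j)) ≫ μ[A] := by
  rw [slide_comp]
  apply eq_of_whiskerRight_mul_comp
  simp only [slide]
  rw [← comp_whiskerRight_assoc, hj]
  simp only [comp_whiskerRight, Category.assoc, MonoidalCategory.whiskerLeft_comp]
  rw [associator_naturality_left_assoc, ← whisker_exchange_assoc, ← whisker_exchange_assoc,
    MonObj.mul_assoc]
  simp

variable [ComonObj A] [IsFrobeniusObj A]

/-- With `Δ(1) = d' ⊗ d''` and `Δ(b) = b d' ⊗ d''`, both sides are `e' x(e'' d') f(d'')`. -/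
theorem comp_conv_mul (x f : A ⟶ A) (e : 𝟙_ C ⟶ A ⊗ A) :
    e ≫ A ◁ conv x f ≫ μ[A] =
      (η[A] ≫ Δ[A]) ≫ ((λ_ A).inv ≫ slide x e) ▷ A ≫ A ◁ f ≫ μ[A] := by
  rw [conv]
  conv_lhs => rw [comul_eq_left]
  generalize η[A] ≫ Δ[A] = d
  have key : d ≫ (λ_ (A ⊗ A)).inv ≫ e ▷ (A ⊗ A) = e ≫ (ρ_ (A ⊗ A)).inv ≫ (A ⊗ A) ◁ d := by
    rw [leftUnitor_inv_naturality_assoc, whisker_exchange, rightUnitor_inv_naturality_assoc,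
      unitors_inv_equal]
  have h1 : ((λ_ A).inv ≫ slide x e) ▷ A = (λ_ (A ⊗ A)).inv ≫ e ▷ (A ⊗ A) ≫
      (α_ A A (A ⊗ A)).hom ≫ A ◁ (α_ A A A).inv ≫ A ◁ (μ[A] ≫ x) ▷ A ≫ (α_ A A A).inv ≫
        μ[A] ▷ A := by
    simp only [slide]
    monoidal
  rw [h1]
  simp only [Category.assoc]
  rw [reassoc_of% key]
  simp only [MonoidalCategory.whiskerLeft_comp, comp_whiskerRight, Category.assoc]
  rw [← whisker_exchange_assoc, MonObj.mul_assoc]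
  monoidal

/-- If `p` generates an ideal of the convolution algebra on which the algebra acts through a left
linear map `J`, then `p` is multiplicative up to a scalar. -/
theorem smul_mul_comp_eq [Preadditive C] [Linear ℂ C] [MonoidalPreadditive C] [MonoidalLinear ℂ C]
    {p : A ⟶ A} {J : A ⟶ A ⊗ A}
    (hJ : μ[A] ≫ J = A ◁ J ≫ (α_ A A A).inv ≫ μ[A] ▷ A) (hp : Δ[A] ≫ p ▷ A = p ≫ J)
    {t : ℂ} (ht : η[A] ≫ p = t • η[A]) :
    t • (μ[A] ≫ p) = p ▷ A ≫ A ◁ p ≫ μ[A] := by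
  -- Contract `(p ⊗ id)Δ = J p` at the unit, where `p(1) = t`.
  have h1 : t • ((λ_ A).inv ≫ contr (η[A] ≫ J)) = p := by
    have h2 := unit_contr_comul p
    rw [hp, reassoc_of% ht, Linear.smul_comp, contr_eq_slide] at h2
    rw [contr_eq_slide, ← Linear.comp_smul]
    conv_rhs => rw [← h2]
    simp [slide]
  -- Here `p(ab)` is the contraction of `J(p(a))` with `b`; by linearity of `J` it is `p(a)` times
  -- the contraction of `J(1)` with `b`.
  rw [← contr_comul, hp, contr_comp, contr_eq_slide, slide_linear _ hJ, ← contr_eq_slide]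
  have h3 : A ◁ p = t • A ◁ ((λ_ A).inv ≫ contr (η[A] ≫ J)) := by
    rw [← MonoidalLinear.whiskerLeft_smul, h1]
  rw [h3]
  simp

end Slide

/-! ### Cocommutativity and the trace formula -/

section Trace

variable {C : Type u} [Category.{v} C] [MonoidalCategory C] [BraidedCategory C] {A : C} [MonObj A]
  [ComonObj A] [IsFrobeniusObj A] [IsCommMonObj A]

/-- For commutative `A`, trivial double braiding converts right linearity of `Δ` into left linearity
of `βΔ`, so uniqueness of the coproduct applies. -/
theorem comul_comm_of_braiding (hβ : (β_ A A).hom ≫ (β_ A A).hom = 𝟙 _) :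
    Δ[A] ≫ (β_ A A).hom = Δ[A] := by
  apply comul_unique
  · have h1 : (β_ A A).hom ≫ Δ[A] ▷ A = A ◁ Δ[A] ≫ (β_ A (A ⊗ A)).hom :=
      (BraidedCategory.braiding_naturality_right _ _).symm
    have h2 : A ◁ μ[A] ≫ (β_ A A).hom = (β_ A (A ⊗ A)).hom ≫ μ[A] ▷ A :=
      BraidedCategory.braiding_naturality_right _ _
    have h3 : A ◁ (β_ A A).hom ≫ A ◁ (β_ A A).hom = 𝟙 _ := by
      rw [← MonoidalCategory.whiskerLeft_comp, hβ, MonoidalCategory.whiskerLeft_id]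
    have h4 : (β_ A A).hom ▷ A ≫ (β_ A A).hom ▷ A = 𝟙 _ := by
      rw [← comp_whiskerRight, hβ, id_whiskerRight]
    conv_rhs =>
      rw [← IsCommMonObj.mul_comm A, Category.assoc,
        ← reassoc_of% IsFrobeniusObj.right_frobenius (A := A), ← IsCommMonObj.mul_comm A,
        MonoidalCategory.whiskerLeft_comp_assoc, h2, reassoc_of% h1]
    simp only [BraidedCategory.braiding_tensor_right_hom, Category.assoc, Iso.inv_hom_id_assoc,
      reassoc_of% h3, Iso.hom_inv_id_assoc, reassoc_of% h4, MonoidalCategory.whiskerLeft_comp]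
  · simp [← BraidedCategory.braiding_naturality_right]

variable [Preadditive C] [MonoidalPreadditive C]

/-- The left side becomes the trace of convolution by `x` once `Hom(𝟙, A)` is identified with the
scalars. Commutativity moves `f i` to the front, where `∑ j i (f i (a)) = 1 ⊗ a` collapses the sum.
-/
theorem sum_comp_conv_mul {I : Type*} [Fintype I] {f : I → (A ⟶ A)} {j : I → (A ⟶ A ⊗ A)}
    (hj : ∀ i, μ[A] ≫ j i = A ◁ j i ≫ (α_ A A A).inv ≫ μ[A] ▷ A)
    (hf : ∑ i, f i ≫ j i = (λ_ A).inv ≫ η[A] ▷ A) (x : A ⟶ A) :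
    ∑ i, (η[A] ≫ j i) ≫ A ◁ conv x (f i) ≫ μ[A] = η[A] ≫ Δ[A] ≫ μ[A] ≫ x := by
  have h1 : ∀ i, ((λ_ A).inv ≫ slide x (η[A] ≫ j i)) ▷ A ≫ A ◁ f i ≫ μ[A] =
      (β_ A A).hom ≫ slide x (f i ≫ j i) := by
    intro i
    rw [slide_comp x (f i), slide_linear x (hj i)]
    generalize (λ_ A).inv ≫ slide x (η[A] ≫ j i) = s
    rw [← MonoidalCategory.tensorHom_def_assoc, ← MonoidalCategory.tensorHom_def_assoc,
      ← BraidedCategory.braiding_naturality_assoc, IsCommMonObj.mul_comm]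
  have h2 : ∑ i, slide x (f i ≫ j i) = μ[A] ≫ x := by
    rw [← slide_unit, ← hf]
    simp only [slide, sum_whiskerRight, Preadditive.sum_comp]
  simp only [comp_conv_mul, h1, ← Preadditive.comp_sum, h2, IsCommMonObj.mul_comm_assoc,
    Category.assoc]

end Trace

/-! ### Linear algebra: traces, reducedness and idempotents -/

section LinearAlgebra

/-- The `f i` need only span: writing `T` as a sum of rank-one maps suffices. -/
theorem trace_eq_sum_of_sum_smul_eq {K M I : Type*} [Field K] [AddCommGroup M] [Module K M]
    [Module.Finite K M] [Fintype I] (f : I → M) (c : I → Module.Dual K M)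
    (h : ∀ x, ∑ i, c i x • f i = x) (T : M →ₗ[K] M) :
    LinearMap.trace K M T = ∑ i, c i (T (f i)) := by
  have hT : T = ∑ i, (c i).smulRight (T (f i)) := by
    ext x
    conv_lhs => rw [← h x]
    simp
  conv_lhs => rw [hT]
  simp [LinearMap.trace_smulRight]

theorem isReduced_of_trace_mul {K R : Type*} [Field K] [CommRing R] [Algebra K R]
    [Module.Finite K R] (φ : R → K) {c : K} (hc : c ≠ 0)
    (htr : ∀ x, LinearMap.trace K R (LinearMap.mulLeft K x) = c * φ x)
    (hφ : ∀ x, (∀ y, φ (x * y) = 0) → x = 0) : IsReduced R := by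
  refine ⟨fun x hx => hφ x fun y => ?_⟩
  have h1 : IsNilpotent (LinearMap.mulLeft K (x * y)) := by
    rw [LinearMap.isNilpotent_mulLeft_iff]
    exact (Commute.all x y).isNilpotent_mul_right hx
  have h2 := (LinearMap.isNilpotent_trace_of_isNilpotent h1).eq_zero
  rw [htr] at h2
  exact (mul_eq_zero.mp h2).resolve_left hc

/-- A reduced Artinian ring is the product of its residue fields, and each of these is `K`. -/
theorem exists_sum_idempotents_eq_one {K R : Type*} [Field K] [IsAlgClosed K] [CommRing R]
    [Algebra K R] [Module.Finite K R] [IsReduced R] :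
    ∃ (n : ℕ) (p : Fin n → R), ∑ i, p i = 1 ∧
      ∀ i, p i * p i = p i ∧ p i ≠ 0 ∧ ∀ r, ∃ c : K, p i * r = c • p i := by
  classical
  have : IsArtinianRing R := IsArtinianRing.of_finite K R
  let e := IsArtinianRing.equivPi R
  let := Fintype.ofFinite (MaximalSpectrum R)
  let q : MaximalSpectrum R → R := fun m => e.symm (Pi.single m 1)
  have hq : ∑ m, q m = 1 := by
    simp only [q]
    rw [← map_sum, Finset.univ_sum_single, ← map_one e.symm]
    rfl
  have hq2 : ∀ m, q m * q m = q m ∧ q m ≠ 0 ∧ ∀ r, ∃ c : K, q m * r = c • q m := by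
    intro m
    refine ⟨?_, ?_, fun r => ?_⟩
    · simp only [q]
      rw [← map_mul, ← Pi.single_mul, one_mul]
    · simp [q]
    · have := m.isMaximal
      let : Field (R ⧸ m.asIdeal) := Ideal.Quotient.field _
      obtain ⟨c, hc⟩ := (IsAlgClosed.algebraMap_bijective_of_isIntegral (k := K)
        (K := R ⧸ m.asIdeal)).2 (Ideal.Quotient.mk _ r)
      refine ⟨c, e.injective ?_⟩
      rw [Algebra.smul_def, map_mul, map_mul]
      funext m'
      by_cases hm : m' = m
      · subst hm
        simp only [q, AlgEquiv.apply_symm_apply, Pi.mul_apply, Pi.single_eq_same, one_mul, mul_one,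
          e, IsArtinianRing.equivPi_apply]
        exact hc.symm
      · simp [q, hm]
  let en := (Fintype.equivFin (MaximalSpectrum R)).symm
  refine ⟨_, q ∘ en, ?_, fun i => hq2 _⟩
  rw [← hq]
  exact en.sum_comp q

end LinearAlgebra

/-! ### The convolution algebra -/

section ConvolutionAlgebra

theorem conv_comm {C : Type u} [Category.{v} C] [MonoidalCategory C] [BraidedCategory C] {A : C}
    [MonObj A] [ComonObj A] [IsCommMonObj A] (hcomul : Δ[A] ≫ (β_ A A).hom = Δ[A])
    (f g : A ⟶ A) : conv f g = conv g f := by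
  rw [conv, conv]
  conv_lhs => rw [← hcomul]
  rw [← MonoidalCategory.tensorHom_def_assoc, ← MonoidalCategory.tensorHom_def_assoc,
    Category.assoc, ← BraidedCategory.braiding_naturality_assoc, IsCommMonObj.mul_comm]

variable {C : Type u} [Category.{v} C] [MonoidalCategory C] [Preadditive C]
  [MonoidalPreadditive C] {A : C} [MonObj A] [ComonObj A]

instance : AddCommGroup (Conv A A) := inferInstanceAs (AddCommGroup (A ⟶ A))

theorem conv_add (f g h : A ⟶ A) : conv f (g + h) = conv f g + conv f h := by
  simp [conv]

theorem add_conv (f g h : A ⟶ A) : conv (f + g) h = conv f h + conv g h := by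
  simp [conv]

theorem conv_sum {I : Type*} (s : Finset I) (f : A ⟶ A) (g : I → (A ⟶ A)) :
    conv f (∑ i ∈ s, g i) = ∑ i ∈ s, conv f (g i) :=
  map_sum (AddMonoidHom.mk' (conv f) (conv_add f)) g s

instance : Ring (Conv A A) :=
  { (inferInstance : AddCommGroup (Conv A A)), (inferInstance : Monoid (Conv A A)) with
    left_distrib := conv_add
    right_distrib := add_conv
    zero_mul := fun f => (by simp [conv] : conv (0 : A ⟶ A) f = 0)
    mul_zero := fun f => (by simp [conv] : conv f (0 : A ⟶ A) = 0) }

variable [Linear ℂ C] [MonoidalLinear ℂ C]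

instance : Module ℂ (Conv A A) := inferInstanceAs (Module ℂ (A ⟶ A))

theorem conv_smul (c : ℂ) (f g : A ⟶ A) : conv f (c • g) = c • conv f g := by
  simp [conv]

theorem smul_conv (c : ℂ) (f g : A ⟶ A) : conv (c • f) g = c • conv f g := by
  simp [conv]

instance : Algebra ℂ (Conv A A) :=
  Algebra.ofModule (fun c f g => smul_conv c f g) (fun c f g => conv_smul c f g)

end ConvolutionAlgebra

/-! ### Consequences of absorption -/

section Absorbing

variable {C : Type u} [Category.{v} C] [MonoidalCategory C] [Preadditive C] {A : C} [MonObj A]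

/-- A decomposition of the left `A`-module `A ⊗ A` as a direct sum of copies of `A`. -/
structure Decomposition (A : C) [MonObj A] (I : Type*) [Fintype I] where
  /-- The projections. -/
  p : I → (A ⊗ A ⟶ A)
  /-- The inclusions. -/
  j : I → (A ⟶ A ⊗ A)
  p_linear : ∀ i, ((α_ A A A).inv ≫ μ[A] ▷ A) ≫ p i = A ◁ p i ≫ μ[A]
  j_linear : ∀ i, μ[A] ≫ j i = A ◁ j i ≫ (α_ A A A).inv ≫ μ[A] ▷ A
  total : ∑ i, p i ≫ j i = 𝟙 (A ⊗ A)

theorem IsAbsorbing.exists_decomposition [MonoidalPreadditive C] (h : IsAbsorbing A) :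
    ∃ N : ℕ, Nonempty (Decomposition A (Fin N)) := by
  obtain ⟨N, -, b, ⟨e⟩, ⟨hb⟩⟩ := h
  refine ⟨N, ⟨⟨fun i => (e.inv ≫ b.π i).hom, fun i => (b.ι i ≫ e.hom).hom,
    fun i => ?_, fun i => ?_, ?_⟩⟩⟩
  · exact (e.inv ≫ b.π i).isModHom.smul_hom
  · exact (b.ι i ≫ e.hom).isModHom.smul_hom
  · have h1 : ∑ i, (e.inv ≫ b.π i) ≫ b.ι i ≫ e.hom = 𝟙 _ := by
      simp only [Category.assoc, ← Preadditive.comp_sum]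
      rw [← e.inv_hom_id]
      congr 1
      simp only [← Category.assoc, ← Preadditive.sum_comp]
      rw [IsBilimit.total hb, Category.id_comp]
    let φ : (freeMod A A ⟶ freeMod A A) →+ (A ⊗ A ⟶ A ⊗ A) := AddMonoidHom.mk' (fun f => f.hom)
      (fun _ _ => rfl)
    have h2 := congrArg φ h1
    rw [map_sum] at h2
    exact h2

namespace Decomposition

variable {I : Type*} [Fintype I] (D : Decomposition A I)

/-- The restriction of the projections to the second factor. -/
def f (i : I) : A ⟶ A := (λ_ A).inv ≫ η[A] ▷ A ≫ D.p i

theorem p_eq (i : I) : D.p i = A ◁ D.f i ≫ μ[A] := by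
  refine eq_of_whiskerRight_mul_comp ?_
  rw [← D.p_linear, Category.assoc, Iso.hom_inv_id_assoc]

theorem sum_f_comp_j : ∑ i, D.f i ≫ D.j i = (λ_ A).inv ≫ η[A] ▷ A := by
  simp only [f, Category.assoc, ← Preadditive.comp_sum, D.total, Category.comp_id]

theorem eq_of_comp_p {X : C} {w w' : X ⟶ A ⊗ A} (h : ∀ i, w ≫ D.p i = w' ≫ D.p i) : w = w' := by
  rw [← Category.comp_id w, ← Category.comp_id w', ← D.total]
  simp only [Preadditive.comp_sum, reassoc_of% h]

theorem comul_comp_p [ComonObj A] (x : A ⟶ A) (i : I) :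
    (Δ[A] ≫ x ▷ A) ≫ D.p i = conv x (D.f i) := by
  rw [D.p_eq, conv, Category.assoc]

/-- The maps `p i : A ⊗ A ⟶ A` are jointly monic, so naturality passes `θ = id` from `A` to `A ⊗ A`;
the balancing axiom does the rest. -/
theorem braiding_sq_eq [BraidedCategory C] [RigidCategory C] [RibbonCategory C]
    (D : Decomposition A I) (h : twist A = 𝟙 A) : (β_ A A).hom ≫ (β_ A A).hom = 𝟙 (A ⊗ A) := by
  have h1 : twist (A ⊗ A) = 𝟙 _ := by
    refine D.eq_of_comp_p fun i => ?_
    have h0 := RibbonCategory.twist_naturality (D.p i)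
    change D.p i ≫ twist A = _ at h0
    rw [Category.id_comp, ← h0, h, Category.comp_id]
  have h2 := RibbonCategory.twist_tensor A A
  change twist (A ⊗ A) = _ ≫ (twist A ⊗ₘ twist A) at h2
  rw [h1, h] at h2
  simpa using h2.symm

/-- Nondegeneracy of the trace form: the components of `(x ⊗ id)Δ(1)` under the `p i` are the values
at the unit of `x * f i`. -/
theorem eq_zero_of_unit_conv [MonoidalPreadditive C] [ComonObj A] [IsFrobeniusObj A]
    (D : Decomposition A I)
    {x : A ⟶ A} (h : ∀ y, η[A] ≫ conv x y = 0) : x = 0 := by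
  have h2 : η[A] ≫ Δ[A] ≫ x ▷ A = 0 := by
    refine D.eq_of_comp_p fun i => ?_
    rw [Category.assoc, D.comul_comp_p, h, zero_comp]
  have h3 := unit_contr_comul x
  rw [h2] at h3
  simpa [contr] using h3.symm

end Decomposition

end Absorbing

/-! ### Semisimplicity of the convolution algebra; its idempotents -/

section Spanning

variable {C : Type u} [Category.{v} C] [MonoidalCategory C] [Preadditive C] [Linear ℂ C]
  [MonoidalPreadditive C] [MonoidalLinear ℂ C] {A : C} [MonObj A]

/-- The coefficients of an endomorphism of `A` with respect to the restricted projections. -/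
def Decomposition.coeff {I : Type*} [Fintype I] (D : Decomposition A I)
    (κ : (𝟙_ C ⟶ A) →ₗ[ℂ] ℂ) (i : I) : (A ⟶ A) →ₗ[ℂ] ℂ where
  toFun f := κ ((η[A] ≫ D.j i) ≫ A ◁ f ≫ μ[A])
  map_add' f g := by
    rw [← map_add, ← Preadditive.comp_add, ← Preadditive.add_comp,
      ← MonoidalPreadditive.whiskerLeft_add]
  map_smul' a f := by
    rw [RingHom.id_apply, ← map_smul, ← Linear.comp_smul, ← Linear.smul_comp,
      ← MonoidalLinear.whiskerLeft_smul]

theorem Decomposition.sum_smul_f {I : Type*} [Fintype I] (D : Decomposition A I)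
    {κ : (𝟙_ C ⟶ A) →ₗ[ℂ] ℂ} (hκ : ∀ x, x = κ x • η[A]) (f : A ⟶ A) :
    ∑ i, D.coeff κ i f • D.f i = f := by
  -- A left linear endomorphism of `A` is the scalar by which it acts on the unit.
  have h1 : ∀ i, D.j i ≫ A ◁ f ≫ μ[A] = D.coeff κ i f • 𝟙 A := by
    intro i
    refine eq_smul_of_mul_comp ?_ ?_
    · rw [reassoc_of% D.j_linear i, ← whisker_exchange_assoc, MonObj.mul_assoc]
      simp
    · rw [← Category.assoc]
      exact hκ ((η[A] ≫ D.j i) ≫ A ◁ f ≫ μ[A])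
  have h2 : ∑ i, D.p i ≫ D.j i ≫ A ◁ f ≫ μ[A] = A ◁ f ≫ μ[A] := by
    conv_rhs => rw [← Category.id_comp (A ◁ f ≫ μ[A]), ← D.total, Preadditive.sum_comp]
    simp only [Category.assoc]
  simp only [h1, Linear.comp_smul, Category.comp_id] at h2
  have h3 := ((λ_ A).inv ≫ η[A] ▷ A) ≫= h2
  rw [Preadditive.comp_sum, Category.assoc, ← whisker_exchange_assoc, MonObj.one_mul] at h3
  simp only [Linear.comp_smul] at h3
  simpa [Decomposition.f] using h3

variable [ComonObj A] [IsFrobeniusObj A]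

theorem Decomposition.sum_coeff_conv [BraidedCategory C] [IsCommMonObj A] {I : Type*} [Fintype I]
    (D : Decomposition A I) (κ : (𝟙_ C ⟶ A) →ₗ[ℂ] ℂ) {l : ℂ} (hΔ : Δ[A] ≫ μ[A] = l • 𝟙 A)
    (x : A ⟶ A) : ∑ i, D.coeff κ i (conv x (D.f i)) = l * κ (η[A] ≫ x) := by
  have h1 := sum_comp_conv_mul D.j_linear D.sum_f_comp_j x
  have h0 : Δ[A] ≫ μ[A] ≫ x = l • x := by
    rw [← Category.assoc, hΔ, Linear.smul_comp, Category.id_comp]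
  rw [h0, Linear.comp_smul] at h1
  have h2 := congrArg κ h1
  rw [map_sum, map_smul] at h2
  exact h2

/-- The convolution algebra, when it is commutative. -/
abbrev convCommRing (hcomm : ∀ f g : Conv A A, f * g = g * f) : CommRing (Conv A A) :=
  { (inferInstance : Ring (Conv A A)) with mul_comm := hcomm }

theorem isReduced_conv [BraidedCategory C] [IsCommMonObj A]
    [hfin : Module.Finite ℂ (A ⟶ A)] {I : Type*} [Fintype I] (D : Decomposition A I)
    (κ : (𝟙_ C ⟶ A) →ₗ[ℂ] ℂ) (hκ : ∀ x, x = κ x • η[A])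
    {l : ℂ} (hl : l ≠ 0) (hΔ : Δ[A] ≫ μ[A] = l • 𝟙 A)
    (hcomm : ∀ f g : Conv A A, f * g = g * f) : IsReduced (Conv A A) := by
  let : CommRing (Conv A A) := convCommRing hcomm
  have : Module.Finite ℂ (Conv A A) := hfin
  refine isReduced_of_trace_mul (K := ℂ) (R := Conv A A)
    (fun x : A ⟶ A => κ (η[A] ≫ x)) hl ?_ ?_
  · intro x
    let L : (A ⟶ A) →ₗ[ℂ] (A ⟶ A) :=
      { toFun := conv x, map_add' := conv_add x, map_smul' := fun c f => conv_smul c x f }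
    exact (trace_eq_sum_of_sum_smul_eq D.f (D.coeff κ) (D.sum_smul_f hκ) L).trans
      (D.sum_coeff_conv κ hΔ x)
  · intro x hx
    refine D.eq_zero_of_unit_conv (x := x) fun y => ?_
    rw [hκ (η[A] ≫ conv x y), show κ (η[A] ≫ conv x y) = 0 from hx y, zero_smul]

theorem exists_isMonHom_of_conv_eq_smul {I : Type*} [Fintype I] (D : Decomposition A I)
    (hunit : ∀ x : 𝟙_ C ⟶ A, ∃ c : ℂ, x = c • η[A]) {p : A ⟶ A} (hp : conv p p = p) (hp0 : p ≠ 0)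
    (h : ∀ f : A ⟶ A, ∃ c : ℂ, conv p f = c • p) :
    ∃ (t : ℂ) (g : A ⟶ A), IsMonHom g ∧ p = t • g := by
  choose c hc using h
  obtain ⟨t, ht⟩ := hunit (η[A] ≫ p)
  -- Since `p * f i` is a multiple of `p`, every component of `(p ⊗ id)Δ` is a multiple of `p`; `J`
  -- assembles the multiples.
  let J : A ⟶ A ⊗ A := ∑ i, c (D.f i) • D.j i
  have hJ : μ[A] ≫ J = A ◁ J ≫ (α_ A A A).inv ≫ μ[A] ▷ A := by
    simp only [J, Preadditive.comp_sum, whiskerLeft_sum, Preadditive.sum_comp, Linear.comp_smul,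
      MonoidalLinear.whiskerLeft_smul, Linear.smul_comp, D.j_linear]
  have hpJ : Δ[A] ≫ p ▷ A = p ≫ J := by
    rw [← Category.comp_id (Δ[A] ≫ p ▷ A), ← D.total, Preadditive.comp_sum, Preadditive.comp_sum]
    refine Finset.sum_congr rfl fun i _ => ?_
    rw [← Category.assoc, D.comul_comp_p, hc, Linear.smul_comp, Linear.comp_smul]
  have hmul := smul_mul_comp_eq hJ hpJ ht
  -- If `t = 0`, then `p(a)p(b) = 0` for all `a`, `b`, so `p * p` vanishes.
  have ht0 : t ≠ 0 := by
    rintro rfl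
    rw [zero_smul] at hmul
    apply hp0
    rw [← hp, conv, ← hmul, comp_zero]
  refine ⟨t, t⁻¹ • p, ⟨?_, ?_⟩, ?_⟩
  · rw [Linear.comp_smul, ht, smul_smul, inv_mul_cancel₀ ht0, one_smul]
  · rw [Linear.comp_smul, MonoidalCategory.tensorHom_def, MonoidalLinear.smul_whiskerRight,
      MonoidalLinear.whiskerLeft_smul]
    simp only [Linear.smul_comp, Linear.comp_smul, Category.assoc, ← hmul, smul_smul]
    rw [mul_assoc, inv_mul_cancel₀ ht0, mul_one]
  · rw [smul_smul, mul_inv_cancel₀ ht0, one_smul]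

/-- The unit of the convolution algebra is a combination of algebra endomorphisms. -/
theorem exists_counit_unit_eq_sum [BraidedCategory C] [IsCommMonObj A]
    [hfin : Module.Finite ℂ (A ⟶ A)] {I : Type*} [Fintype I] (D : Decomposition A I)
    (κ : (𝟙_ C ⟶ A) →ₗ[ℂ] ℂ) (hκ : ∀ x, x = κ x • η[A])
    {l : ℂ} (hl : l ≠ 0) (hΔ : Δ[A] ≫ μ[A] = l • 𝟙 A)
    (hcomul : Δ[A] ≫ (β_ A A).hom = Δ[A]) :
    ∃ (n : ℕ) (t : Fin n → ℂ) (g : Fin n → (A ⟶ A)), (∀ i, IsMonHom (g i)) ∧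
      ε[A] ≫ η[A] = ∑ i, t i • g i := by
  have hcomm : ∀ f g : Conv A A, f * g = g * f := conv_comm hcomul
  have hred := isReduced_conv D κ hκ hl hΔ hcomm
  let : CommRing (Conv A A) := convCommRing hcomm
  have : Module.Finite ℂ (Conv A A) := hfin
  obtain ⟨n, p, hsum, hp⟩ := exists_sum_idempotents_eq_one (K := ℂ) (R := Conv A A)
  have h1 := fun i => exists_isMonHom_of_conv_eq_smul D (fun x => ⟨κ x, hκ x⟩) (hp i).1 (hp i).2.1
    (hp i).2.2
  choose t g hg htg using h1
  refine ⟨n, t, g, hg, ?_⟩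
  rw [← Finset.sum_congr rfl fun i _ => htg i]
  exact hsum.symm

end Spanning

/-! ### Algebra automorphisms and their finiteness -/

section AlgAut

variable {C : Type u} [Category.{v} C] [MonoidalCategory C] {A : C} [MonObj A]

/-- The underlying morphism of an algebra automorphism. -/
def autHom (g : AlgAut A) : A ⟶ A := g.hom.hom

instance (g : AlgAut A) : IsMonHom (autHom g) := g.hom.isMonHom_hom

theorem autHom_injective : Function.Injective (autHom (A := A)) := fun _ _ h =>
  Iso.ext (Mon.Hom.ext h)

theorem autHom_mul (g h : AlgAut A) : autHom (g * h) = autHom h ≫ autHom g := rfl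

theorem autHom_one : autHom (1 : AlgAut A) = 𝟙 A := rfl

theorem autHom_comp_autHom_inv (g : AlgAut A) : autHom g ≫ autHom g⁻¹ = 𝟙 A := by
  rw [← autHom_mul, inv_mul_cancel, autHom_one]

theorem autHom_inv_comp_autHom (g : AlgAut A) : autHom g⁻¹ ≫ autHom g = 𝟙 A := by
  rw [← autHom_mul, mul_inv_cancel, autHom_one]

theorem isIso_autHom (g : AlgAut A) : IsIso (autHom g) :=
  ⟨autHom g⁻¹, autHom_comp_autHom_inv g, autHom_inv_comp_autHom g⟩

theorem exists_autHom_eq (g : A ⟶ A) [IsMonHom g] [IsIso g] : ∃ h : AlgAut A, autHom h = g :=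
  ⟨Mon.mkIso' (asIso g), rfl⟩

end AlgAut

section Finite

variable {C : Type u} [Category.{v} C] [Preadditive C] [Linear ℂ C]

/-- Composition with `g` is injective on a finite-dimensional space, hence surjective. -/
theorem isIso_of_split {X : C} [Module.Finite ℂ (X ⟶ X)] {g r : X ⟶ X} (h : g ≫ r = 𝟙 X) :
    IsIso g := by
  have hinj : Function.Injective (Linear.rightComp ℂ X g) := by
    intro a b hab
    have := congrArg (· ≫ r) hab
    simpa [h] using this
  obtain ⟨s, hs⟩ := LinearMap.surjective_of_injective hinj (𝟙 X)
  have hs' : s ≫ g = 𝟙 X := hs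
  have : s = r := by rw [← Category.comp_id s, ← h, reassoc_of% hs']
  exact ⟨r, h, this ▸ hs'⟩

variable [MonoidalCategory C] [MonoidalPreadditive C] [MonoidalLinear ℂ C] {A : C} [MonObj A]
  [ComonObj A] [IsFrobeniusObj A]

theorem isIso_of_isMonHom [Module.Finite ℂ (A ⟶ A)]
    (hunit : ∀ x : 𝟙_ C ⟶ A, ∃ c : ℂ, x = c • η[A]) (h0 : η[A] ≫ ε[A] ≠ 0)
    (g : A ⟶ A) [IsMonHom g] : IsIso g := by
  obtain ⟨r, hr⟩ := counit_comp_split (hom_counit_of_isMonHom hunit h0 g)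
  exact isIso_of_split hr

/-- If the unit of the convolution algebra is a combination of algebra endomorphisms, then the
automorphism group is finite and its elements sum to a multiple of that unit. -/
theorem finite_algAut_and_sum [Module.Finite ℂ (A ⟶ A)]
    (hunit : ∀ x : 𝟙_ C ⟶ A, ∃ c : ℂ, x = c • η[A]) (h0 : η[A] ≫ ε[A] ≠ 0)
    {l : ℂ} (hΔ : Δ[A] ≫ μ[A] = l • 𝟙 A) {n : ℕ} {t : Fin n → ℂ}
    {g : Fin n → (A ⟶ A)} (hg : ∀ i, IsMonHom (g i)) (hsum : ε[A] ≫ η[A] = ∑ i, t i • g i) :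
    ∃ _ : Fintype (AlgAut A), ∑ k : AlgAut A, autHom k = l • (ε[A] ≫ η[A]) := by
  classical
  have hη : η[A] ≠ 0 := fun h => h0 (by rw [h, zero_comp])
  have hne : ∀ k : AlgAut A, autHom k ≠ 0 := fun k hk => hη (by
    rw [← IsMonHom.one_hom (autHom k), hk, comp_zero])
  have hex : ∀ i, ∃ h : AlgAut A, autHom h = g i := fun i =>
    have := isIso_of_isMonHom hunit h0 (g i)
    exists_autHom_eq (g i)
  choose h hh using hex
  simp only [← hh] at hsum
  have horth : ∀ k k' : AlgAut A, k ≠ k' → conv (autHom k) (autHom k') = 0 := fun k k' hk =>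
    conv_eq_zero hunit _ _ (autHom_injective.ne hk)
  have hself : ∀ k : AlgAut A, conv (autHom k) (autHom k) = l • autHom k := fun k => by
    rw [conv_self, hΔ, Linear.smul_comp, Category.id_comp]
  -- An automorphism absent from the sum would be orthogonal to the unit of the convolution algebra,
  -- hence zero.
  have hsurj : Function.Surjective h := by
    intro k
    by_contra! hk
    apply hne k
    rw [← conv_counit_unit (autHom k), hsum, conv_sum]
    refine Finset.sum_eq_zero fun i _ => ?_
    rw [conv_smul, horth k (h i) (hk i).symm, smul_zero]
  have hfin : Finite (AlgAut A) := Finite.of_surjective h hsurj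
  let F : Fintype (AlgAut A) := Fintype.ofFinite _
  refine ⟨F, ?_⟩
  -- The indexing `h` is not known to be injective, so coefficients of equal automorphisms are
  -- collected.
  let c : AlgAut A → ℂ := fun k => ∑ i with h i = k, t i
  have hc : ε[A] ≫ η[A] = ∑ k, c k • autHom k := by
    rw [hsum, ← Finset.sum_fiberwise Finset.univ h]
    refine Finset.sum_congr rfl fun k _ => ?_
    rw [Finset.sum_smul]
    refine Finset.sum_congr rfl fun i hi => ?_
    rw [(Finset.mem_filter.mp hi).2]
  have hcl : ∀ k, l * c k = 1 := by
    intro k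
    have h1 := conv_counit_unit (autHom k)
    rw [hc, conv_sum, Finset.sum_eq_single k (fun k' _ hk' => by
      rw [conv_smul, horth k k' hk'.symm, smul_zero]) (by simp), conv_smul, hself, smul_smul,
      mul_comm] at h1
    have h2 : (l * c k - 1) • autHom k = 0 := by rw [sub_smul, h1, one_smul, sub_self]
    exact sub_eq_zero.mp ((smul_eq_zero.mp h2).resolve_right (hne k))
  rw [hc, Finset.smul_sum]
  refine Finset.sum_congr rfl fun k _ => ?_
  rw [smul_smul, hcl, one_smul]

end Finite

/-! ### Projections and inclusions between `FV` and the twists of `V` -/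

section Action

variable {C : Type u} [Category.{v} C] [MonoidalCategory C] {A : C} [MonObj A]

/-- The action morphism of a module. -/
def act (V : CategoryTheory.Mod C A) : A ⊗ V.X ⟶ V.X := V.mod.smul

theorem unit_act (V : CategoryTheory.Mod C A) : η[A] ▷ V.X ≫ act V = (λ_ V.X).hom :=
  V.mod.one_smul

theorem mul_act (V : CategoryTheory.Mod C A) :
    μ[A] ▷ V.X ≫ act V = (α_ A A V.X).hom ≫ A ◁ act V ≫ act V :=
  V.mod.mul_smul

theorem act_hom {V W : CategoryTheory.Mod C A} (f : V ⟶ W) :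
    act V ≫ f.hom = A ◁ f.hom ≫ act W :=
  f.isModHom.smul_hom

/-- Construct a module morphism from a linear morphism. -/
def homMk {V W : CategoryTheory.Mod C A} (f : V.X ⟶ W.X) (h : act V ≫ f = A ◁ f ≫ act W) : V ⟶ W :=
  Mod.Hom.mk' f h

theorem act_freeMod (X : C) : act (freeMod A X) = (α_ A A X).inv ≫ μ[A] ▷ X := rfl

theorem act_T (g : AlgAut A) (V : CategoryTheory.Mod C A) :
    act (T g V) = autHom g⁻¹ ▷ V.X ≫ act V := rfl

/-- The action, as a module morphism from the free module to the twisted module. -/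
def twistProj (g : AlgAut A) (V : CategoryTheory.Mod C A) : freeMod A V.X ⟶ T g V :=
  homMk (autHom g⁻¹ ▷ V.X ≫ act V) (by
    rw [act_freeMod, act_T]
    change ((α_ A A V.X).inv ≫ μ[A] ▷ V.X) ≫ autHom g⁻¹ ▷ V.X ≫ act V =
      A ◁ (autHom g⁻¹ ▷ V.X ≫ act V) ≫ autHom g⁻¹ ▷ V.X ≫ act V
    rw [Category.assoc, ← comp_whiskerRight_assoc, IsMonHom.mul_hom, comp_whiskerRight_assoc,
      mul_act]
    simp [whisker_exchange_assoc, MonoidalCategory.tensorHom_def'])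

variable [ComonObj A]

/-- The map `v ↦ a' ⊗ a'' v`, where `a' ⊗ a''` is the coproduct of the unit. -/
def coact (V : CategoryTheory.Mod C A) : V.X ⟶ A ⊗ V.X :=
  (λ_ V.X).inv ≫ (η[A] ≫ Δ[A]) ▷ V.X ≫ (α_ A A V.X).hom ≫ A ◁ act V

/-- The composite sends `v` to `h⁻¹(g(d')) d'' v`, the action of the convolution of `h⁻¹g` with
`id`, evaluated at the unit. -/
theorem twistIncl_comp_twistProj [Preadditive C] [Linear ℂ C] [MonoidalPreadditive C]
    [MonoidalLinear ℂ C] (g h : AlgAut A) (V : CategoryTheory.Mod C A) {c : ℂ}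
    (hc : conv (autHom g ≫ autHom h⁻¹) (𝟙 A) = c • 𝟙 A) :
    (coact V ≫ autHom g ▷ V.X) ≫ autHom h⁻¹ ▷ V.X ≫ act V = c • 𝟙 V.X := by
  have h1 := congrArg (fun f => (λ_ V.X).inv ≫ (η[A] ≫ f) ▷ V.X ≫ act V) hc
  simp only [Linear.comp_smul, MonoidalLinear.smul_whiskerRight, Linear.smul_comp,
    Category.comp_id, unit_act, Iso.inv_hom_id] at h1
  rw [← h1, Category.assoc, ← comp_whiskerRight_assoc]
  generalize autHom g ≫ autHom h⁻¹ = k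
  rw [coact, conv]
  simp only [comp_whiskerRight, Category.assoc, MonoidalCategory.whiskerLeft_id,
    Category.id_comp, mul_act]
  rw [whisker_exchange_assoc, ← associator_naturality_left_assoc]

variable [IsFrobeniusObj A]

theorem act_coact (V : CategoryTheory.Mod C A) :
    act V ≫ coact V = Δ[A] ▷ V.X ≫ (α_ A A V.X).hom ≫ A ◁ act V := by
  conv_rhs => rw [comul_eq_right]
  rw [coact]
  generalize η[A] ≫ Δ[A] = d
  rw [leftUnitor_inv_naturality_assoc, whisker_exchange_assoc, associator_naturality_right_assoc]
  have h1 : A ◁ A ◁ act V ≫ A ◁ act V =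
      A ◁ (α_ A A V.X).inv ≫ A ◁ μ[A] ▷ V.X ≫ A ◁ act V := by
    simp only [← MonoidalCategory.whiskerLeft_comp, mul_act, Iso.inv_hom_id_assoc]
  rw [h1]
  monoidal

/-- On elements, `g(g⁻¹(a) d') ⊗ d'' = a g(d') ⊗ d''`; this makes `twistIncl` linear. -/
theorem autHom_inv_comul (g : AlgAut A) :
    autHom g⁻¹ ≫ Δ[A] ≫ autHom g ▷ A =
      (ρ_ A).inv ≫ A ◁ (η[A] ≫ Δ[A]) ≫ (α_ A A A).inv ≫ (A ◁ autHom g) ▷ A ≫ μ[A] ▷ A := by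
  conv_lhs => rw [comul_eq_left]
  generalize η[A] ≫ Δ[A] = d
  have h1 : autHom g⁻¹ ▷ A ≫ μ[A] ≫ autHom g = A ◁ autHom g ≫ μ[A] := by
    rw [IsMonHom.mul_hom, MonoidalCategory.tensorHom_def', Category.assoc,
      ← whisker_exchange_assoc, ← comp_whiskerRight_assoc, autHom_inv_comp_autHom]
    simp
  have h2 := congrArg (fun f => (ρ_ A).inv ≫ A ◁ d ≫ (α_ A A A).inv ≫ f ▷ A) h1
  simp only [comp_whiskerRight] at h2
  simp only [Category.assoc]
  rw [← h2, rightUnitor_inv_naturality_assoc, ← whisker_exchange_assoc,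
    associator_inv_naturality_left_assoc]

/-- The inclusion of a twisted module into the free module, up to a scalar. -/
def twistIncl (g : AlgAut A) (V : CategoryTheory.Mod C A) : T g V ⟶ freeMod A V.X :=
  homMk (coact V ≫ autHom g ▷ V.X) (by
    rw [act_freeMod, act_T]
    change (autHom g⁻¹ ▷ V.X ≫ act V) ≫ coact V ≫ autHom g ▷ V.X =
      A ◁ (coact V ≫ autHom g ▷ V.X) ≫ (α_ A A V.X).inv ≫ μ[A] ▷ V.X
    have h1 := congrArg (fun f => f ▷ V.X ≫ (α_ A A V.X).hom ≫ A ◁ act V) (autHom_inv_comul g)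
    simp only [comp_whiskerRight, Category.assoc] at h1
    rw [Category.assoc, reassoc_of% act_coact V, whisker_exchange,
      ← associator_naturality_left_assoc, h1, coact]
    generalize η[A] ≫ Δ[A] = d
    have h2 : A ◁ A ◁ act V ≫ A ◁ autHom g ▷ V.X ≫ (α_ A A V.X).inv ≫ μ[A] ▷ V.X =
        A ◁ autHom g ▷ (A ⊗ V.X) ≫ (α_ A A (A ⊗ V.X)).inv ≫ μ[A] ▷ (A ⊗ V.X) ≫ A ◁ act V := by
      rw [← MonoidalCategory.whiskerLeft_comp_assoc, whisker_exchange,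
        MonoidalCategory.whiskerLeft_comp_assoc, associator_inv_naturality_right_assoc,
        whisker_exchange]
    simp only [MonoidalCategory.whiskerLeft_comp, Category.assoc, h2]
    monoidal)

theorem sum_twistProj_comp_twistIncl [Preadditive C] [Linear ℂ C] [MonoidalPreadditive C]
    [MonoidalLinear ℂ C] [Fintype (AlgAut A)] {l : ℂ}
    (hcounit : ∀ g : AlgAut A, autHom g ≫ ε[A] = ε[A])
    (hsum : ∑ k : AlgAut A, autHom k = l • (ε[A] ≫ η[A])) (V : CategoryTheory.Mod C A) :
    ∑ g : AlgAut A, (autHom g⁻¹ ▷ V.X ≫ act V) ≫ coact V ≫ autHom g ▷ V.X = l • 𝟙 (A ⊗ V.X) := by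
  -- As `g⁻¹` respects `Δ`, the summand is `a ⊗ v ↦ a' ⊗ g⁻¹(a'') v`, and `g` occurs only once, so
  -- the sum formula applies.
  have h1 : ∀ g : AlgAut A, (autHom g⁻¹ ▷ V.X ≫ act V) ≫ coact V ≫ autHom g ▷ V.X =
      (Δ[A] ≫ A ◁ autHom g⁻¹) ▷ V.X ≫ (α_ A A V.X).hom ≫ A ◁ act V := by
    intro g
    have h2 : autHom g⁻¹ ≫ Δ[A] ≫ autHom g ▷ A = Δ[A] ≫ A ◁ autHom g⁻¹ := by
      have := isIso_autHom g⁻¹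
      have : IsMonHom (asIso (autHom g⁻¹)).hom := inferInstanceAs (IsMonHom (autHom g⁻¹))
      have h3 := hom_comul_of_hom_counit (asIso (autHom g⁻¹)) (hcounit g⁻¹)
      rw [asIso_hom, MonoidalCategory.tensorHom_def'] at h3
      rw [reassoc_of% h3, ← comp_whiskerRight, autHom_inv_comp_autHom]
      simp
    rw [Category.assoc, reassoc_of% act_coact V, whisker_exchange,
      ← associator_naturality_left_assoc, ← h2]
    simp only [comp_whiskerRight, Category.assoc]
  simp only [h1]
  rw [← Preadditive.sum_comp, ← sum_whiskerRight, ← Preadditive.comp_sum, ← whiskerLeft_sum,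
    Fintype.sum_equiv (Equiv.inv _) (fun g : AlgAut A => autHom g⁻¹) autHom (fun _ => rfl), hsum]
  simp only [MonoidalLinear.whiskerLeft_smul, Linear.comp_smul, MonoidalLinear.smul_whiskerRight,
    Linear.smul_comp, MonoidalCategory.whiskerLeft_comp, ComonObj.comul_counit_assoc]
  congr 1
  simp only [comp_whiskerRight, Category.assoc, associator_naturality_middle_assoc,
    ← MonoidalCategory.whiskerLeft_comp, unit_act]
  simp

end Action

theorem act_kernel_lift {C : Type u} [Category.{v} C] [MonoidalCategory C] [Preadditive C]
    [MonoidalPreadditive C] [HasKernels C] {A : C} {U V W : C} {u : A ⊗ U ⟶ U}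
    {v : A ⊗ V ⟶ V} {w : A ⊗ W ⟶ W} {g : U ⟶ V}
    (hg : u ≫ g = A ◁ g ≫ v) {f : V ⟶ W} (hf : v ≫ f = A ◁ f ≫ w) (h : g ≫ f = 0) :
    u ≫ kernel.lift f g h = A ◁ kernel.lift f g h ≫ kernel.lift f (A ◁ kernel.ι f ≫ v) (by
      rw [Category.assoc, hf, ← MonoidalCategory.whiskerLeft_comp_assoc, kernel.condition]
      simp) := by
  rw [← cancel_mono (kernel.ι f), Category.assoc, Category.assoc, kernel.lift_ι, kernel.lift_ι,
    hg, ← MonoidalCategory.whiskerLeft_comp_assoc, kernel.lift_ι]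

/-! ### Linear structure, free modules and kernels in `Mod C A` -/

section ModuleCategory

variable {C : Type u} [Category.{v} C] [MonoidalCategory C] [Preadditive C]
  [MonoidalPreadditive C] {A : C} [MonObj A]

theorem hom_add {V W : CategoryTheory.Mod C A} (f g : V ⟶ W) : (f + g).hom = f.hom + g.hom := rfl

theorem hom_sum {V W : CategoryTheory.Mod C A} {I : Type*} (s : Finset I) (f : I → (V ⟶ W)) :
    (∑ i ∈ s, f i).hom = ∑ i ∈ s, (f i).hom :=
  map_sum (AddMonoidHom.mk' (fun f : V ⟶ W => f.hom) hom_add) f s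

section Linear

theorem whiskerLeft_unit_act {C : Type u} [Category.{v} C] [MonoidalCategory C] {A : C} [MonObj A]
    {X : C} {W : CategoryTheory.Mod C A} {φ : A ⊗ X ⟶ W.X}
    (h : ((α_ A A X).inv ≫ μ[A] ▷ X) ≫ φ = A ◁ φ ≫ act W) :
    A ◁ (((λ_ X).inv ≫ η[A] ▷ X) ≫ φ) ≫ act W = φ := by
  rw [MonoidalCategory.whiskerLeft_comp, MonoidalCategory.whiskerLeft_comp, Category.assoc,
    Category.assoc, ← h, Category.assoc, associator_inv_naturality_middle_assoc,
    ← comp_whiskerRight_assoc, MonObj.mul_one]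
  simp

variable [Linear ℂ C] [MonoidalLinear ℂ C]

instance (V W : CategoryTheory.Mod C A) : SMul ℂ (V ⟶ W) :=
  ⟨fun c f => homMk (c • f.hom) (by
    rw [Linear.comp_smul, act_hom, MonoidalLinear.whiskerLeft_smul, Linear.smul_comp])⟩

theorem hom_smul {V W : CategoryTheory.Mod C A} (c : ℂ) (f : V ⟶ W) :
    (c • f).hom = c • f.hom := rfl

instance (V W : CategoryTheory.Mod C A) : Module ℂ (V ⟶ W) :=
  Function.Injective.module ℂ (AddMonoidHom.mk' (fun f : V ⟶ W => f.hom) hom_add)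
    (fun f g h => Mod.hom_ext f g h) hom_smul

instance : Linear ℂ (CategoryTheory.Mod C A) where
  smul_comp _ _ _ _ _ _ := Mod.hom_ext _ _ (Linear.smul_comp _ _ _ _ _ _)
  comp_smul _ _ _ _ _ _ := Mod.hom_ext _ _ (Linear.comp_smul _ _ _ _ _ _)

/-- The underlying morphism, as a linear map. -/
def homLinearMap (V W : CategoryTheory.Mod C A) : (V ⟶ W) →ₗ[ℂ] (V.X ⟶ W.X) where
  toFun f := f.hom
  map_add' := hom_add
  map_smul' := hom_smul

theorem finite_hom (V W : CategoryTheory.Mod C A) [Module.Finite ℂ (V.X ⟶ W.X)] :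
    Module.Finite ℂ (V ⟶ W) :=
  Module.Finite.of_injective (homLinearMap V W) fun f g h => Mod.hom_ext f g h

/-- The inclusion of the generating object in a free module. -/
def unitFree (X : C) : X ⟶ (freeMod A X).X := (λ_ X).inv ≫ η[A] ▷ X

/-- Morphisms out of a free module are morphisms out of its generating object. -/
def freeHomEquiv (X : C) (W : CategoryTheory.Mod C A) : (freeMod A X ⟶ W) ≃ₗ[ℂ] (X ⟶ W.X) where
  toFun f := unitFree X ≫ f.hom
  map_add' f g := by
    rw [hom_add, Preadditive.comp_add]
  map_smul' c f := by
    rw [hom_smul, Linear.comp_smul, RingHom.id_apply]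
  invFun f := homMk (A ◁ f ≫ act W) (by
    rw [act_freeMod]
    change ((α_ A A X).inv ≫ μ[A] ▷ X) ≫ A ◁ f ≫ act W = A ◁ (A ◁ f ≫ act W) ≫ act W
    rw [Category.assoc, ← whisker_exchange_assoc, mul_act]
    simp)
  left_inv f := by
    apply Mod.hom_ext
    exact whiskerLeft_unit_act (act_hom f)
  right_inv f := by
    change ((λ_ X).inv ≫ η[A] ▷ X) ≫ A ◁ f ≫ act W = f
    rw [Category.assoc, ← whisker_exchange_assoc, unit_act]
    simp

end Linear

section Kernels

variable [HasKernels C]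

/-- The kernel of a module morphism. -/
noncomputable def kernelMod {V W : CategoryTheory.Mod C A} (f : V ⟶ W) : CategoryTheory.Mod C A :=
  letI : ModObj A (kernel f.hom) :=
    { smul := kernel.lift f.hom (A ◁ kernel.ι f.hom ≫ act V) (by
        rw [Category.assoc, act_hom, ← MonoidalCategory.whiskerLeft_comp_assoc, kernel.condition]
        simp)
      one_smul := by
        rw [← cancel_mono (kernel.ι f.hom)]
        change (η[A] ▷ kernel f.hom ≫ kernel.lift _ _ _) ≫ _ = (λ_ (kernel f.hom)).hom ≫ _
        rw [Category.assoc, kernel.lift_ι, ← whisker_exchange_assoc, unit_act]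
        simp
      mul_smul := by
        rw [← cancel_mono (kernel.ι f.hom)]
        change (μ[A] ▷ kernel f.hom ≫ kernel.lift _ _ _) ≫ _ =
          ((α_ A A (kernel f.hom)).hom ≫ A ◁ kernel.lift _ _ _ ≫ kernel.lift _ _ _) ≫ _
        simp only [Category.assoc, kernel.lift_ι]
        rw [← whisker_exchange_assoc, mul_act, ← MonoidalCategory.whiskerLeft_comp_assoc,
          kernel.lift_ι]
        simp }
  ⟨kernel f.hom⟩

/-- The inclusion of the kernel of a module morphism. -/
noncomputable def kernelModι {V W : CategoryTheory.Mod C A} (f : V ⟶ W) : kernelMod f ⟶ V :=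
  homMk (kernel.ι f.hom) (kernel.lift_ι _ _ _)

/-- Kernels are what Schur's lemma for simple modules requires. -/
instance : HasKernels (CategoryTheory.Mod C A) where
  has_limit {V W} f := by
    have hw : kernelModι f ≫ f = 0 := Mod.hom_ext _ _ (kernel.condition f.hom)
    refine HasLimit.mk ⟨KernelFork.ofι (kernelModι f) hw, KernelFork.IsLimit.ofι _ _
      (fun {U} g hg => homMk (kernel.lift f.hom g.hom (congrArg Mod.Hom.hom hg)) ?_) ?_ ?_⟩
    · exact act_kernel_lift (act_hom g) (act_hom f) (congrArg Mod.Hom.hom hg)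
    · intro U g hg
      exact Mod.hom_ext _ _ (kernel.lift_ι _ _ _)
    · intro U g hg m hm
      apply Mod.hom_ext
      exact (cancel_mono (kernel.ι f.hom)).mp
        ((congrArg Mod.Hom.hom hm).trans (kernel.lift_ι _ _ _).symm)

end Kernels

end ModuleCategory

/-! ### Twisting as an action of the automorphism group -/

section Twisting

variable {C : Type u} [Category.{v} C] [MonoidalCategory C] {A : C} [MonObj A]

/-- Construct an isomorphism of modules from a linear isomorphism. -/
def isoMk {V W : CategoryTheory.Mod C A} (e : V.X ≅ W.X) (h : act V ≫ e.hom = A ◁ e.hom ≫ act W) :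
    V ≅ W where
  hom := homMk e.hom h
  inv := homMk e.inv (by
    rw [Iso.comp_inv_eq, Category.assoc, h, ← MonoidalCategory.whiskerLeft_comp_assoc]
    simp)
  hom_inv_id := Mod.hom_ext _ _ e.hom_inv_id
  inv_hom_id := Mod.hom_ext _ _ e.inv_hom_id

/-- Twisting, as a functor. -/
abbrev twistFunctor (g : AlgAut A) : CategoryTheory.Mod C A ⥤ CategoryTheory.Mod C A :=
  Mod.comap (D := C) (g⁻¹).hom.hom

/-- Twisting by a product. -/
def TMulIso (g h : AlgAut A) (V : CategoryTheory.Mod C A) : T (g * h) V ≅ T g (T h V) :=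
  isoMk (Iso.refl V.X) (by
    rw [act_T, act_T, act_T, mul_inv_rev, autHom_mul]
    change (_ ▷ V.X ≫ act V) ≫ 𝟙 V.X = A ◁ 𝟙 V.X ≫ autHom g⁻¹ ▷ V.X ≫ autHom h⁻¹ ▷ V.X ≫ act V
    simp)

/-- Twisting by the identity. -/
def TOneIso (V : CategoryTheory.Mod C A) : T 1 V ≅ V :=
  isoMk (Iso.refl V.X) (by
    rw [act_T, inv_one, autHom_one]
    change (_ ▷ V.X ≫ act V) ≫ 𝟙 V.X = A ◁ 𝟙 V.X ≫ act V
    simp)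

/-- Twisting an isomorphism. -/
def TMapIso (g : AlgAut A) {V W : CategoryTheory.Mod C A} (e : V ≅ W) : T g V ≅ T g W :=
  (twistFunctor g).mapIso e

theorem linear_of_twist (g : AlgAut A) {V W : C} {a : A ⊗ V ⟶ V} {b : A ⊗ W ⟶ W} {f : V ⟶ W}
    (h : (autHom g⁻¹ ▷ V ≫ a) ≫ f = A ◁ f ≫ autHom g⁻¹ ▷ W ≫ b) : a ≫ f = A ◁ f ≫ b := by
  rw [whisker_exchange_assoc, Category.assoc] at h
  have := isIso_autHom g⁻¹
  exact (cancel_epi (autHom g⁻¹ ▷ V)).mp h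

instance (g : AlgAut A) : (twistFunctor g).IsEquivalence where
  faithful := ⟨fun {V W} f f' h => by
    have h1 : ((twistFunctor g).map f).hom = ((twistFunctor g).map f').hom := by rw [h]
    exact Mod.hom_ext f f' h1⟩
  full := ⟨fun {V W} f => ⟨homMk f.hom (linear_of_twist g (act_hom f)), rfl⟩⟩
  essSurj := ⟨fun V => ⟨T g⁻¹ V, ⟨(TMulIso g g⁻¹ V).symm ≪≫
    eqToIso (by rw [mul_inv_cancel]) ≪≫ TOneIso V⟩⟩⟩

theorem simple_T [Preadditive C] [MonoidalPreadditive C] (g : AlgAut A)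
    (V : CategoryTheory.Mod C A) [Simple V] : Simple (T g V) :=
  simple_obj (twistFunctor g) V

/-- The stabilizer of the isomorphism class of a module. -/
def stabilizer (V : CategoryTheory.Mod C A) : Subgroup (AlgAut A) where
  carrier := {g | Nonempty (T g V ≅ V)}
  mul_mem' := fun {g h} ⟨a⟩ ⟨b⟩ => ⟨TMulIso g h V ≪≫ TMapIso g b ≪≫ a⟩
  one_mem' := ⟨TOneIso V⟩
  inv_mem' := fun {g} ⟨a⟩ => ⟨TMapIso g⁻¹ a.symm ≪≫ (TMulIso g⁻¹ g V).symm ≪≫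
    eqToIso (by rw [inv_mul_cancel]) ≪≫ TOneIso V⟩

theorem setOf_T_iso_eq {V W : CategoryTheory.Mod C A} {h : AlgAut A} (e : T h V ≅ W) :
    {g : AlgAut A | Nonempty (T g V ≅ W)} =
      (fun k => h * k) '' (stabilizer V : Set (AlgAut A)) := by
  ext g
  constructor
  · rintro ⟨a⟩
    refine ⟨h⁻¹ * g, ⟨TMulIso h⁻¹ g V ≪≫ TMapIso h⁻¹ (a ≪≫ e.symm) ≪≫ (TMulIso h⁻¹ h V).symm ≪≫
      eqToIso (by rw [inv_mul_cancel]) ≪≫ TOneIso V⟩, by simp⟩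
  · rintro ⟨k, ⟨a⟩, rfl⟩
    exact ⟨TMulIso h k V ≪≫ TMapIso h a ≪≫ e⟩

end Twisting

theorem IsDirectSum.finrank_hom {D : Type*} [Category D] [Preadditive D] [Linear ℂ D] {I : Type*}
    [Fintype I] {X : D} {Y : I → D} (h : IsDirectSum X Y) (W : D)
    [∀ i, Module.Finite ℂ (Y i ⟶ W)] :
    Module.finrank ℂ (X ⟶ W) = ∑ i, Module.finrank ℂ (Y i ⟶ W) := by
  classical
  obtain ⟨b, ⟨e⟩, ⟨hb⟩⟩ := h
  let E : (X ⟶ W) ≃ₗ[ℂ] (∀ i, Y i ⟶ W) :=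
    { toFun := fun f i => b.ι i ≫ e.hom ≫ f
      map_add' := fun f g => by
        funext i
        simp
      map_smul' := fun c f => by
        funext i
        simp
      invFun := fun φ => e.inv ≫ ∑ i, b.π i ≫ φ i
      left_inv := fun f => by
        have h1 : ∑ i, b.π i ≫ b.ι i ≫ e.hom ≫ f = e.hom ≫ f := by
          simp only [← Category.assoc, ← Preadditive.sum_comp]
          rw [IsBilimit.total hb, Category.id_comp]
        change e.inv ≫ ∑ i, b.π i ≫ b.ι i ≫ e.hom ≫ f = f
        rw [h1, Iso.inv_hom_id_assoc]
      right_inv := fun φ => by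
        funext i
        simp only [Iso.hom_inv_id_assoc, Preadditive.comp_sum]
        rw [Finset.sum_eq_single i]
        · simp
        · intro j _ hj
          rw [← Category.assoc, bicone_ι_π_ne b hj.symm, zero_comp]
        · simp }
  rw [E.finrank_eq, Module.finrank_pi_fintype]


/-! ### Decomposition of free modules and the dimension count -/

section FreeModules

variable {C : Type u} [Category.{v} C] [MonoidalCategory C] [Preadditive C] [Linear ℂ C]
  [MonoidalPreadditive C] [MonoidalLinear ℂ C] {A : C} [MonObj A]

/-- The dimension of the space of morphisms between simple modules counts the twists that relate
them. -/
theorem finrank_hom_eq_ncard [HasKernels C] [Fintype (AlgAut A)]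
    [∀ X Y : C, Module.Finite ℂ (X ⟶ Y)] (V W : CategoryTheory.Mod C A) [Simple V] [Simple W]
    (hV : IsDirectSum (freeMod A V.X) (fun g : AlgAut A => T g V)) :
    Module.finrank ℂ (V.X ⟶ W.X) = {g : AlgAut A | Nonempty (T g V ≅ W)}.ncard := by
  classical
  have hfin : ∀ V W : CategoryTheory.Mod C A, FiniteDimensional ℂ (V ⟶ W) :=
    fun V W => finite_hom V W
  have h1 : ∀ g : AlgAut A, Module.finrank ℂ (T g V ⟶ W) =
      if Nonempty (T g V ≅ W) then 1 else 0 := by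
    intro g
    have := simple_T g V
    split_ifs with h
    · exact (finrank_hom_simple_simple_eq_one_iff ℂ _ _).mpr h
    · exact finrank_hom_simple_simple_eq_zero_of_not_iso ℂ fun e => h ⟨e⟩
  -- Frobenius reciprocity replaces `Hom(V, W)` by module maps out of `FV`, which split over the
  -- twists.
  rw [← (freeHomEquiv V.X W).finrank_eq, hV.finrank_hom, Finset.sum_congr rfl fun g _ => h1 g,
    Finset.sum_boole, Nat.cast_id, Set.ncard_eq_toFinset_card']
  simp

variable [ComonObj A] [IsFrobeniusObj A]

/-- The factor `l⁻¹` on the inclusions compensates for `id * id = l id`. -/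
theorem freeMod_isDirectSum [Fintype (AlgAut A)]
    (hunit : ∀ x : 𝟙_ C ⟶ A, ∃ c : ℂ, x = c • η[A]) (h0 : η[A] ≫ ε[A] ≠ 0)
    {l : ℂ} (hl : l ≠ 0) (hΔ : Δ[A] ≫ μ[A] = l • 𝟙 A)
    (hsum : ∑ k : AlgAut A, autHom k = l • (ε[A] ≫ η[A])) (V : CategoryTheory.Mod C A) :
    IsDirectSum (freeMod A V.X) (fun g : AlgAut A => T g V) := by
  classical
  have hself : ∀ g : AlgAut A, (l⁻¹ • twistIncl g V) ≫ twistProj g V = 𝟙 (T g V) := by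
    intro g
    apply Mod.hom_ext
    have h1 : conv (autHom g ≫ autHom g⁻¹) (𝟙 A) = l • 𝟙 A := by
      rw [autHom_comp_autHom_inv, conv_self, hΔ, Category.comp_id]
    change (l⁻¹ • (coact V ≫ autHom g ▷ V.X)) ≫ autHom g⁻¹ ▷ V.X ≫ act V = 𝟙 V.X
    rw [Linear.smul_comp, twistIncl_comp_twistProj g g V h1, smul_smul, inv_mul_cancel₀ hl,
      one_smul]
  have hne : ∀ g h : AlgAut A, g ≠ h → (l⁻¹ • twistIncl g V) ≫ twistProj h V = 0 := by
    intro g h hgh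
    apply Mod.hom_ext
    have h1 : conv (autHom g ≫ autHom h⁻¹) (𝟙 A) = (0 : ℂ) • 𝟙 A := by
      rw [zero_smul, ← autHom_mul, ← autHom_one]
      refine conv_eq_zero hunit _ _ (autHom_injective.ne fun h2 => hgh ?_)
      exact (inv_mul_eq_one.mp h2).symm
    change (l⁻¹ • (coact V ≫ autHom g ▷ V.X)) ≫ autHom h⁻¹ ▷ V.X ≫ act V = 0
    rw [Linear.smul_comp, twistIncl_comp_twistProj g h V h1, zero_smul, smul_zero]
  let b : Bicone (fun g : AlgAut A => T g V) :=
    ⟨freeMod A V.X, fun g => twistProj g V, fun g => l⁻¹ • twistIncl g V, fun g h => by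
      split_ifs with hgh
      · subst hgh
        exact hself g
      · exact hne g h hgh⟩
  refine ⟨b, ⟨Iso.refl _⟩, ⟨isBilimitOfTotal b ?_⟩⟩
  apply Mod.hom_ext
  rw [hom_sum]
  change ∑ g : AlgAut A, (autHom g⁻¹ ▷ V.X ≫ act V) ≫ (l⁻¹ • (coact V ≫ autHom g ▷ V.X)) =
    𝟙 (A ⊗ V.X)
  simp only [Linear.comp_smul]
  rw [← Finset.smul_sum, sum_twistProj_comp_twistIncl
    (fun g => hom_counit_of_isMonHom hunit h0 (autHom g)) hsum, smul_smul, inv_mul_cancel₀ hl,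
    one_smul]

end FreeModules

theorem exists_unit_coeff {C : Type u} [Category.{v} C] [MonoidalCategory C] [Preadditive C]
    [Linear ℂ C] [MonoidalPreadditive C] {A : C} [MonObj A]
    (hunit : Module.finrank ℂ (𝟙_ C ⟶ A) = 1) :
    ∃ κ : (𝟙_ C ⟶ A) →ₗ[ℂ] ℂ, ∀ x, x = κ x • η[A] := by
  have hη : η[A] ≠ 0 := by
    intro h
    have h1 : 𝟙 A = 0 := by
      have := MonObj.one_mul A
      rw [h] at this
      rw [← Iso.inv_hom_id (λ_ A), ← this]
      simp
    have : Subsingleton (𝟙_ C ⟶ A) :=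
      ⟨fun a b => by rw [← Category.comp_id a, ← Category.comp_id b, h1, comp_zero, comp_zero]⟩
    rw [Module.finrank_zero_of_subsingleton] at hunit
    exact zero_ne_one hunit
  have hsurj : ∀ x : 𝟙_ C ⟶ A, ∃ c : ℂ, c • η[A] = x :=
    (finrank_eq_one_iff_of_nonzero' η[A] hη).mp hunit
  let e := LinearEquiv.ofBijective (LinearMap.toSpanSingleton ℂ (𝟙_ C ⟶ A) η[A])
    ⟨fun a b hab => smul_left_injective ℂ hη hab, hsurj⟩
  exact ⟨e.symm.toLinearMap, fun x => (e.apply_symm_apply x).symm⟩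

end AnyonCond

theorem mainTheorem5 {C : Type u} [Category.{v} C] [Abelian C] [Linear ℂ C]
    [MonoidalCategory C] [MonoidalPreadditive C] [MonoidalLinear ℂ C] [BraidedCategory C]
    [RigidCategory C] [AnyonCond.RibbonCategory C] [AnyonCond.ModularTensorCategory C]
    (A : C) [MonObj A] [ComonObj A] [AnyonCond.IsFrobeniusObj A] [IsCommMonObj A]
    (hsep : AnyonCond.IsStronglySeparable A)
    (hunit : Module.finrank ℂ (𝟙_ C ⟶ A) = 1)
    (htwist : AnyonCond.twist A = 𝟙 A)
    (habs : AnyonCond.IsAbsorbing A) :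
    Finite (AnyonCond.AlgAut A) ∧
    -- (i)
    (∀ V : CategoryTheory.Mod C A, Simple V →
      AnyonCond.IsDirectSum (AnyonCond.freeMod A V.X)
        (fun g : AnyonCond.AlgAut A => AnyonCond.T g V)) ∧
    -- (ii)
    (∀ V : CategoryTheory.Mod C A, Simple V →
      ∃ K : Subgroup (AnyonCond.AlgAut A),
        (∀ g, g ∈ K ↔ Nonempty (AnyonCond.T g V ≅ V)) ∧
        Nat.card K = Module.finrank ℂ (V.X ⟶ V.X) ∧
        ∀ V' : CategoryTheory.Mod C A, Simple V' → Nonempty (V.X ≅ V'.X) →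
          {g : AnyonCond.AlgAut A | Nonempty (AnyonCond.T g V ≅ V')}.Nonempty ∧
          {g : AnyonCond.AlgAut A | Nonempty (AnyonCond.T g V ≅ V')}.ncard =
            Module.finrank ℂ (V.X ⟶ V.X) ∧
          ∃ h : AnyonCond.AlgAut A,
            {g : AnyonCond.AlgAut A | Nonempty (AnyonCond.T g V ≅ V')} =
              (fun k => h * k) '' (K : Set (AnyonCond.AlgAut A))) ∧
    -- (iii)
    (∀ V W : CategoryTheory.Mod C A, Simple V → Simple W →
      Nonempty (V.X ≅ W.X) ∨ ∀ f : V.X ⟶ W.X, f = 0) := by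
  have hfin : ∀ X Y : C, Module.Finite ℂ (X ⟶ Y) :=
    AnyonCond.ModularTensorCategory.finiteDimensional_hom
  have hsimple : Simple (𝟙_ C) := AnyonCond.ModularTensorCategory.simple_unit
  obtain ⟨l, l', hl, hl', hΔ, hε⟩ := hsep
  obtain ⟨κ, hκ⟩ := AnyonCond.exists_unit_coeff hunit
  have hκ' : ∀ x : 𝟙_ C ⟶ A, ∃ c : ℂ, x = c • MonObj.one := fun x => ⟨κ x, hκ x⟩
  have h0 : (MonObj.one : 𝟙_ C ⟶ A) ≫ ComonObj.counit ≠ 0 := by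
    rw [hε]
    exact smul_ne_zero hl' (id_nonzero _)
  obtain ⟨N, ⟨D⟩⟩ := habs.exists_decomposition
  have hcomul := AnyonCond.comul_comm_of_braiding (D.braiding_sq_eq htwist)
  obtain ⟨n, t, g, hg, hgsum⟩ := AnyonCond.exists_counit_unit_eq_sum D κ hκ hl hΔ hcomul
  obtain ⟨F, hsum⟩ := AnyonCond.finite_algAut_and_sum hκ' h0 hΔ hg hgsum
  have hfree := AnyonCond.freeMod_isDirectSum hκ' h0 hl hΔ hsum
  have hcard : ∀ V W : CategoryTheory.Mod C A, Simple V → Simple W →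
      Module.finrank ℂ (V.X ⟶ W.X) =
        {g : AnyonCond.AlgAut A | Nonempty (AnyonCond.T g V ≅ W)}.ncard :=
    fun V W _ _ => AnyonCond.finrank_hom_eq_ncard V W (hfree V)
  have hiso : ∀ (V W : CategoryTheory.Mod C A) (g : AnyonCond.AlgAut A),
      Nonempty (AnyonCond.T g V ≅ W) → Nonempty (V.X ≅ W.X) := fun V W g ⟨e⟩ =>
    ⟨(Mod.forget A).mapIso (X := AnyonCond.T g V) (Y := W) e⟩
  refine ⟨Finite.of_fintype _, fun V _ => hfree V, fun V hV => ?_, fun V W hV hW => ?_⟩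
  · refine ⟨AnyonCond.stabilizer V, fun _ => Iff.rfl, (hcard V V hV hV).symm, ?_⟩
    rintro V' hV' ⟨e⟩
    have hVV' : Module.finrank ℂ (V.X ⟶ V'.X) = Module.finrank ℂ (V.X ⟶ V.X) :=
      (Linear.homCongr ℂ (Iso.refl V.X) e).symm.finrank_eq
    -- This set has as many elements as the stabilizer of `V`, which contains the identity.
    have hne : {g : AnyonCond.AlgAut A | Nonempty (AnyonCond.T g V ≅ V')}.Nonempty := by
      rw [← Set.ncard_pos (Set.toFinite _), ← hcard V V' hV hV', hVV', hcard V V hV hV,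
        Set.ncard_pos (Set.toFinite _)]
      exact ⟨1, ⟨AnyonCond.TOneIso V⟩⟩
    refine ⟨hne, by rw [← hcard V V' hV hV', hVV'], ?_⟩
    obtain ⟨h, ⟨a⟩⟩ := hne
    exact ⟨h, AnyonCond.setOf_T_iso_eq a⟩
  -- Twisting does not change the underlying object, so any `g` counted here gives `V ≅ W` in `C`;
  -- an empty count means dimension zero.
  · by_cases hemp : {g : AnyonCond.AlgAut A | Nonempty (AnyonCond.T g V ≅ W)}.Nonempty
    · obtain ⟨g, hg⟩ := hemp
      exact Or.inl (hiso V W g hg)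
    · right
      have hzero : Module.finrank ℂ (V.X ⟶ W.X) = 0 := by
        rw [hcard V W hV hW, Set.not_nonempty_iff_eq_empty.mp hemp, Set.ncard_empty]
      have := Module.finrank_zero_iff.mp hzero
      exact fun f => Subsingleton.elim f 0
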